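/- Let $1\le n$, and let $\Phi$ be a $C^\infty$ map from a closed ball $\bar B\subset\mathbb{R}^d$ of positive finite radius to $\mathbb{R}^n$. Let $\psi$ be a (real- or complex-valued) $C^1$ function with compact support in the open ball $B$, and let $\mu=\Phi_*(\psi\,d\tau)$ be the transported measure, defined by $\int_{\mathbb{R}^n} f\,d\mu=\int_{\bar B} f(\Phi(\tau))\psi(\tau)\,d\tau$. For $0<\delta\le 1$, let $L^1_\delta(\mathbb{R}^n)$ be the space of all $h\in L^1(\mathbb{R}^n)$ for which there is a constant $A$ with $$\int_{\mathbb{R}^n}|h(y-z)-h(y)|\,dy\le A|z|^\delta\quad\text{for all } z\in\mathbb{R}^n,$$ normed by $\|h\|_{L^1_\delta}=\|h\|_{L^1}+(\text{the smallest such }A)$. **Proposition 7.2.** Let $J$ be the determinant of some $n\times n$ sub-matrix of the Jacobian matrix $\partial\Phi/\partial\tau$, and assume that for some multi-index $\alpha$, with $|\alpha|=k\ge 0$, one has $\partial_\tau^\alpha J(\tau)\ne 0$ for every $\tau\in\bar B$. Then $\mu$ is absolutely continuous with respect to Lebesgue measure, and its Radon–Nikodym derivative $h$ belongs to $L^1_\delta(\mathbb{R}^n)$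 for every $\delta\in(0,1]$ with $2k\delta<1$ (that is, $\delta<1/(2k)$ if $k\ge1$, and every $\delta\in(0,1]$ if $k=0$). Moreover, for all such $\delta$ and all real $M$, $L$ and $b>0$ there is a constant $C$, depending only on $n,d,k,\delta,M,b,L$, such that $\|h\|_{L^1_\delta}\le C$ for all $\bar B$, $\Phi$, $\psi$, $J$, $\alpha$ as above with $|\alpha|=k$, $\|\Phi\|_{C^{k+2}(\bar B)}\le M$, $\inf_{\bar B}|\partial_\tau^\alpha J|\ge b$ and $\|\psi\|_{C^1(\bar B)}\le L$. -/

import Mathlib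

open MeasureTheory Set Metric
open scoped ENNReal NNReal ContDiff

noncomputable section

namespace TransportedMeasure

/-- `ℝ^m` with its Euclidean norm and Lebesgue measure. -/
abbrev Euc (m : ℕ) : Type := EuclideanSpace ℝ (Fin m)

/-- The `C^m` norm on `s`: the supremum over `s` of the norms of all derivatives of order at most
`m`, with value `∞` if one of them is unbounded. Derivatives are taken within `s`, so that on a
closed ball they are one-sided at the boundary. -/
def ckNorm {V W : Type*} [NormedAddCommGroup V] [NormedSpace ℝ V]
    [NormedAddCommGroup W] [NormedSpace ℝ W] (m : ℕ) (f : V → W) (s : Set V) : ℝ≥0∞ :=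
  ⨆ j ∈ Finset.range (m + 1), ⨆ x ∈ s, ‖iteratedFDerivWithin ℝ j f s x‖ₑ

/-- The list of variables of a multi-index `α`: the variable `i` is repeated `α i` times. -/
def variableList {d : ℕ} (α : Fin d → ℕ) : List (Fin d) :=
  (List.finRange d).flatMap fun i => List.replicate (α i) i

/-- The partial derivative `∂^α f (x)` within `s`, that is, the derivative of order `|α|`
evaluated at the coordinate vectors prescribed by `α`. -/
def partialDeriv {d : ℕ} (α : Fin d → ℕ) (f : Euc d → ℝ) (s : Set (Euc d)) (x : Euc d) : ℝ :=
  iteratedFDerivWithin ℝ (variableList α).length f s x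
    fun j => EuclideanSpace.single ((variableList α).get j) (1 : ℝ)

/-- The Jacobian matrix `∂Φ/∂τ` (`n` rows, `d` columns). -/
def jacobianMatrix {n d : ℕ} (Φ : Euc d → Euc n) (s : Set (Euc d)) (τ : Euc d) :
    Matrix (Fin n) (Fin d) ℝ :=
  Matrix.of fun i j => fderivWithin ℝ Φ s τ (EuclideanSpace.single j (1 : ℝ)) i

/-- The determinant of the `n × n` sub-matrix of the Jacobian matrix formed by the columns
`e 0 < e 1 < ⋯ < e (n - 1)`. -/
def jacobianMinor {n d : ℕ} (Φ : Euc d → Euc n) (s : Set (Euc d)) (e : Fin n ↪o Fin d)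
    (τ : Euc d) : ℝ :=
  ((jacobianMatrix Φ s τ).submatrix id e).det

/-- `Φ` is a `C^∞` map on the closed ball of centre `c` and radius `R`, and `ψ` is a `C^1` density
with compact support in the open ball (extended by zero to the whole space). Values of `Φ` outside
the closed ball are irrelevant. -/
structure IsTransportSetting {𝕜 : Type*} [RCLike 𝕜] {n d : ℕ} (c : Euc d) (R : ℝ)
    (Φ : Euc d → Euc n) (ψ : Euc d → 𝕜) : Prop where
  radius_pos : 0 < R
  smooth_map : ContDiffOn ℝ ∞ Φ (closedBall c R)
  contDiff_density : ContDiff ℝ 1 ψ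
  support_subset : tsupport ψ ⊆ ball c R

/-- The transported measure `Φ_*(ψ dτ)`: the measure `ψ dτ` on the closed ball, pushed forward to
`ℝ^n` under the restriction of `Φ` to the closed ball. -/
def transport {𝕜 : Type*} [RCLike 𝕜] {n d : ℕ} (c : Euc d) (R : ℝ)
    (Φ : Euc d → Euc n) (ψ : Euc d → 𝕜) : VectorMeasure (Euc n) 𝕜 :=
  (((volume : Measure (Euc d)).comap
      (Subtype.val : closedBall c R → Euc d)).withDensityᵥ fun τ => ψ τ).map
    fun τ : closedBall c R => Φ τ

/-- `h` is the Radon-Nikodym derivative of `μ` with respect to Lebesgue measure: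
`h` is integrable and `dμ = h dy`. -/
def IsLebesgueDensity {𝕜 : Type*} [RCLike 𝕜] {n : ℕ} (μ : VectorMeasure (Euc n) 𝕜)
    (h : Euc n → 𝕜) : Prop :=
  Integrable h ∧ μ = (volume : Measure (Euc n)).withDensityᵥ h

/-- `∫ |h(y - z) - h(y)| dy ≤ A |z|^δ` for all `z`. -/
def HasTranslationBound {𝕜 : Type*} [RCLike 𝕜] {n : ℕ} (δ : ℝ) (h : Euc n → 𝕜) (A : ℝ≥0) :
    Prop :=
  ∀ z : Euc n, ∫⁻ y, ‖h (y - z) - h y‖ₑ ≤ A * ‖z‖ₑ ^ δ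

/-- Membership in `L^1_δ(ℝ^n)`. -/
def MemL1Delta {𝕜 : Type*} [RCLike 𝕜] {n : ℕ} (δ : ℝ) (h : Euc n → 𝕜) : Prop :=
  MemLp h 1 ∧ ∃ A : ℝ≥0, HasTranslationBound δ h A

/-- The `L^1_δ` norm: the `L^1` norm plus the smallest `A` in the translation bound
(`∞` if there is none). -/
def l1DeltaNorm {𝕜 : Type*} [RCLike 𝕜] {n : ℕ} (δ : ℝ) (h : Euc n → 𝕜) : ℝ≥0∞ :=
  eLpNorm h 1 volume + ⨅ (A : ℝ≥0) (_ : HasTranslationBound δ h A), (A : ℝ≥0∞)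

end TransportedMeasure

end

noncomputable section

namespace TransportedMeasure

/-! By duality it suffices to bound `∫ (f(Φ + z) - f(Φ)) ψ` by `C |z|^δ` for smooth compactly
supported `f` with `|f| ≤ 1`. Put `s = |z|` and split `ψ` with the weights `J²/(J² + s)` and `s/(J²
+ s)`. The second part costs at most `2L ∫ s/(J² + s)`. In the first, the difference of `f` is an
integral of derivatives of `f` in the direction `z`. Cramer's rule writes `J z` as a combination of
columns of the Jacobian matrix, so one factor `J` turns these into derivatives of `f ∘ Φ`. An
integration by parts then removes all derivatives from `f`, and the differentiated weight is
`O(|z|/(J² + s))`. Both parts are thus controlled by `∫ s/(J² + s)` over a ball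
(`abs_integral_fderiv_comp_le`, `exists_integral_translate_sub_le`).

It remains to see that this integral is `O(s^δ)`. Since `s/(J² + s) ≤ s^δ |J|^(-2δ)`, what is needed
is integrability of `|J|^(-2δ)`. On a line along which the `k`-th derivative is bounded below, `|J|`
dominates a constant times a product of `k` factors `|t - a i|`, so `2kδ < 1` suffices
(`exists_mul_prod_abs_sub_le`). Polarization finds, near each point, one of finitely many directions
in which the pure `k`-th derivative is large, and Fubini sums over parallel segments
(`exists_lintegral_div_sq_add_le`).

The constant must not depend on the radius. A minor is a divergence of quantities bounded by `M`,
hence `∂^α J` cannot exceed `b` in modulus on a very large ball (`exists_radius_le`).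

Finally the smooth estimate passes to Borel sets and says that small translations move the measure
little in total variation. Almost every translate of the measure gives mass zero to a given null
set, so the measure itself does, and a density exists (`setIntegral_preimage_eq_zero_of_null`,
`exists_density`). Its `L^1_δ` norm is read off from the same estimate. -/

/-! ### Lower bounds in one variable from a lower bound on the `k`-th derivative -/

/-- The derivative of order `j` of the Hadamard quotient `(g t - g a) / (t - a)`, where `G j` is the
`j`-th derivative of `g`. -/
def hadamardQuotient (G : ℕ → ℝ → ℝ) (a : ℝ) (j : ℕ) (t : ℝ) : ℝ :=
  ∫ s in (0 : ℝ)..1, s ^ j * G (j + 1) (a + s * (t - a))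

/-- Differentiation under the integral sign, the inner derivative supplying one more factor `s`. The
quotient thus comes with a full sequence of derivatives, in the format required of `G`, and an
induction can be applied to it. -/
theorem hasDerivAt_hadamardQuotient {G : ℕ → ℝ → ℝ}
    (hG : ∀ j t, HasDerivAt (G j) (G (j + 1) t) t) (a : ℝ) (j : ℕ) (t : ℝ) :
    HasDerivAt (hadamardQuotient G a j) (hadamardQuotient G a (j + 1) t) t := by
  have hc : ∀ j, Continuous (G j) := fun j =>
    continuous_iff_continuousAt.2 fun t => (hG j t).continuousAt
  obtain ⟨C, hC⟩ := (isCompact_closedBall a (|t - a| + 1)).exists_bound_of_continuousOn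
    (hc (j + 2)).continuousOn
  refine (intervalIntegral.hasDerivAt_integral_of_dominated_loc_of_deriv_le
    (F := fun t s => s ^ j * G (j + 1) (a + s * (t - a)))
    (F' := fun t s => s ^ (j + 1) * G (j + 2) (a + s * (t - a)))
    (bound := fun _ => C) (Metric.ball_mem_nhds t one_pos) ?_ ?_ ?_ ?_ ?_ ?_).2
  · refine Filter.Eventually.of_forall fun x => Continuous.aestronglyMeasurable ?_
    have := hc (j + 1)
    fun_prop
  · have := hc (j + 1)
    apply Continuous.intervalIntegrable
    fun_prop
  · refine Continuous.aestronglyMeasurable ?_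
    have := hc (j + 2)
    fun_prop
  · refine Filter.Eventually.of_forall fun s hs x hx => ?_
    rw [uIoc_of_le zero_le_one] at hs
    rw [norm_mul, norm_pow, Real.norm_eq_abs, abs_of_pos hs.1]
    have h1 : ‖G (j + 2) (a + s * (x - a))‖ ≤ C := by
      apply hC
      rw [mem_closedBall, Real.dist_eq, add_sub_cancel_left, abs_mul, abs_of_pos hs.1]
      have h2 : |x - a| ≤ |t - a| + 1 := by
        have := abs_sub_le x t a
        have h3 : |x - t| < 1 := by rwa [mem_ball, Real.dist_eq] at hx
        linarith
      calc s * |x - a| ≤ 1 * |x - a| := by gcongr; exact hs.2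
        _ ≤ _ := by linarith
    calc s ^ (j + 1) * ‖G (j + 2) (a + s * (x - a))‖
        ≤ 1 * ‖G (j + 2) (a + s * (x - a))‖ := by
          gcongr; exact pow_le_one₀ hs.1.le hs.2
      _ ≤ C := by linarith
  · simp
  · refine Filter.Eventually.of_forall fun s hs x hx => ?_
    have h1 : HasDerivAt (fun x => a + s * (x - a)) s x := by
      simpa using (((hasDerivAt_id x).sub_const a).const_mul s).const_add a
    have h2 := ((hG (j + 1) (a + s * (x - a))).comp x h1).const_mul (s ^ j)
    refine h2.congr_deriv ?_
    change s ^ j * (G (j + 2) (a + s * (x - a)) * s) = _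
    ring

theorem sub_eq_mul_hadamardQuotient {G : ℕ → ℝ → ℝ}
    (hG : ∀ j t, HasDerivAt (G j) (G (j + 1) t) t) (a t : ℝ) :
    G 0 t - G 0 a = (t - a) * hadamardQuotient G a 0 t := by
  have hc : Continuous (G 1) :=
    continuous_iff_continuousAt.2 fun t => (hG 1 t).continuousAt
  have h : ∫ s in (0 : ℝ)..1, G 1 (a + s * (t - a)) * (t - a) =
      G 0 (a + 1 * (t - a)) - G 0 (a + 0 * (t - a)) := by
    apply intervalIntegral.integral_eq_sub_of_hasDerivAt (f := fun s => G 0 (a + s * (t - a)))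
    · intro s _
      have h1 : HasDerivAt (fun s => a + s * (t - a)) (t - a) s := by
        simpa using ((hasDerivAt_id s).mul_const (t - a)).const_add a
      exact (hG 0 _).comp s h1
    · apply Continuous.intervalIntegrable
      fun_prop
  rw [intervalIntegral.integral_mul_const] at h
  simp only [one_mul, add_sub_cancel, zero_mul, add_zero] at h
  rw [← h, hadamardQuotient]
  simp [mul_comm]

theorem forall_le_or_forall_le_neg_of_le_abs {X : Type*} [TopologicalSpace X] {g : X → ℝ}
    {s : Set X} {l : ℝ} (hs : IsPreconnected s) (hg : ContinuousOn g s) (hl : 0 < l)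
    (h : ∀ t ∈ s, l ≤ |g t|) :
    (∀ t ∈ s, l ≤ g t) ∨ (∀ t ∈ s, g t ≤ -l) := by
  by_contra! hcon
  obtain ⟨⟨x, hx, hx'⟩, y, hy, hy'⟩ := hcon
  have hx1 : g x ≤ 0 := by
    rcases le_abs.1 (h x hx) with h1 | h1 <;> linarith
  have hy1 : 0 ≤ g y := by
    rcases le_abs.1 (h y hy) with h1 | h1 <;> linarith
  obtain ⟨w, hw, hw'⟩ := hs.intermediate_value hx hy hg ⟨hx1, hy1⟩
  have := h w hw
  rw [hw', abs_zero] at this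
  linarith

/-- The derivative `G (k + 1)` keeps its sign on the interval, and the points `a + s (t - a)` stay
there, so nothing cancels in the average against `s ^ k`, whose mass is `1 / (k + 1)`. -/
theorem le_abs_hadamardQuotient {G : ℕ → ℝ → ℝ}
    (hG : ∀ j t, HasDerivAt (G j) (G (j + 1) t) t) {p q l : ℝ} (hl : 0 < l) {k : ℕ}
    (h : ∀ t ∈ Icc p q, l ≤ |G (k + 1) t|) {a : ℝ} (ha : a ∈ Icc p q) :
    ∀ t ∈ Icc p q, l / (k + 1) ≤ |hadamardQuotient G a k t| := by
  have hc : Continuous (G (k + 1)) :=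
    continuous_iff_continuousAt.2 fun t => (hG (k + 1) t).continuousAt
  have hpow : ∫ s in (0 : ℝ)..1, s ^ k * l = l / (k + 1) := by
    rw [intervalIntegral.integral_mul_const, integral_pow]
    simp
    ring
  have hmem : ∀ t ∈ Icc p q, ∀ s ∈ Icc (0 : ℝ) 1, a + s * (t - a) ∈ Icc p q := by
    intro t ht s hs
    have := (convex_Icc p q).add_smul_sub_mem ha ht hs
    simpa using this
  intro t ht
  have hi : IntervalIntegrable (fun s => s ^ k * G (k + 1) (a + s * (t - a))) volume 0 1 := by
    apply Continuous.intervalIntegrable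
    fun_prop
  have hi' : IntervalIntegrable (fun s => s ^ k * l) volume 0 1 := by
    apply Continuous.intervalIntegrable
    fun_prop
  rcases forall_le_or_forall_le_neg_of_le_abs isPreconnected_Icc hc.continuousOn hl h with h1 | h1
  · refine le_trans ?_ (le_abs_self _)
    rw [← hpow]
    apply intervalIntegral.integral_mono_on zero_le_one hi' hi
    intro s hs
    exact mul_le_mul_of_nonneg_left (h1 _ (hmem t ht s hs)) (pow_nonneg hs.1 _)
  · refine le_trans ?_ (neg_le_abs _)
    rw [← hpow, le_neg, ← intervalIntegral.integral_neg]
    apply intervalIntegral.integral_mono_on zero_le_one hi hi'.neg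
    intro s hs
    have := mul_le_mul_of_nonneg_left (h1 _ (hmem t ht s hs)) (pow_nonneg hs.1 k)
    change s ^ k * _ ≤ -(s ^ k * l)
    linarith

/-- A function whose `k`-th derivative is bounded below is bounded below by a polynomial
with `k` real roots. -/
theorem exists_mul_prod_abs_sub_le {k : ℕ} {p q : ℝ} (hpq : p ≤ q) {G : ℕ → ℝ → ℝ}
    (hG : ∀ j t, HasDerivAt (G j) (G (j + 1) t) t) {l : ℝ} (hl : 0 < l)
    (h : ∀ t ∈ Icc p q, l ≤ |G k t|) :
    ∃ a : Fin k → ℝ, ∀ t ∈ Icc p q, l / k.factorial * ∏ i, |t - a i| ≤ |G 0 t| := by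
  induction k generalizing G l with
  | zero => exact ⟨Fin.elim0, fun t ht => by simpa using h t ht⟩
  | succ k ih =>
    have hc : Continuous (G 0) :=
      continuous_iff_continuousAt.2 fun t => (hG 0 t).continuousAt
    -- The root split off is a minimum point of `|G 0|`, since a zero need not exist.
    obtain ⟨a, ha, hmin⟩ := isCompact_Icc.exists_isMinOn (nonempty_Icc.2 hpq)
      (f := fun t => |G 0 t|) hc.abs.continuousOn
    have hmin' : ∀ t ∈ Icc p q, |G 0 a| ≤ |G 0 t| := fun t ht => hmin ht
    obtain ⟨b, hb⟩ := ih (hasDerivAt_hadamardQuotient hG a) (l := l / (k + 1)) (by positivity)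
      (le_abs_hadamardQuotient hG hl h ha)
    -- If the minimum is positive, `G 0` has constant sign; subtracting the value of same sign and
    -- least modulus cannot increase the modulus.
    have key : ∀ t ∈ Icc p q, |G 0 t - G 0 a| ≤ |G 0 t| := by
      intro t ht
      rcases eq_or_ne (G 0 a) 0 with h0 | h0
      · simp [h0]
      · rcases forall_le_or_forall_le_neg_of_le_abs isPreconnected_Icc hc.continuousOn
          (abs_pos.2 h0) hmin' with h1 | h1
        · have h2 := h1 t ht
          have h3 := h1 a ha
          have h4 := abs_nonneg (G 0 a)
          rw [abs_of_nonneg (h4.trans h2), abs_le]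
          have h5 := le_abs_self (G 0 a)
          constructor <;> linarith
        · have h2 := h1 t ht
          have h3 := h1 a ha
          have h4 := abs_nonneg (G 0 a)
          rw [abs_of_nonpos (a := G 0 t) (by linarith), abs_le]
          have h5 := neg_le_abs (G 0 a)
          constructor <;> linarith
    refine ⟨Fin.cons a b, fun t ht => ?_⟩
    rw [Fin.prod_univ_succ]
    simp only [Fin.cons_zero, Fin.cons_succ]
    calc l / (k + 1).factorial * (|t - a| * ∏ i, |t - b i|)
        = |t - a| * (l / (k + 1) / k.factorial * ∏ i, |t - b i|) := by
          rw [Nat.factorial_succ]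
          push_cast
          field_simp
      _ ≤ |t - a| * |hadamardQuotient G a 0 t| := by
          gcongr
          exact hb t ht
      _ = |G 0 t - G 0 a| := by rw [sub_eq_mul_hadamardQuotient hG, abs_mul]
      _ ≤ _ := key t ht

/-! ### The integral of `s / (G² + s)` on an interval -/

/-- The largest factor dominates the others; the summand `1` is there for the empty product. Applied
to `|t - a i| ^ (-2δ)`, it trades a product of singularities for a sum of single ones of exponent
`2kδ < 1`. -/
theorem prod_le_one_add_sum_pow {k : ℕ} (y : Fin k → ℝ) (hy : ∀ i, 0 ≤ y i) :
    ∏ i, y i ≤ 1 + ∑ i, y i ^ k := by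
  rcases k with _ | k
  · simp
  obtain ⟨m, -, hm⟩ := Finset.exists_max_image Finset.univ y Finset.univ_nonempty
  calc ∏ i, y i ≤ ∏ _i : Fin (k + 1), y m :=
        Finset.prod_le_prod (fun i _ => hy i) (fun i hi => hm i hi)
    _ = y m ^ (k + 1) := by simp
    _ ≤ ∑ i, y i ^ (k + 1) :=
        Finset.single_le_sum (f := fun i => y i ^ (k + 1))
          (fun i _ => pow_nonneg (hy i) _) (Finset.mem_univ m)
    _ ≤ _ := by linarith

/-- With `u = s / P²`, the left side is at most `min 1 u`, hence at most `u ^ δ` because `0 < δ ≤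
1`. -/
theorem div_sq_add_le_rpow {s δ g P : ℝ} (hs : 0 < s) (hδ : 0 < δ) (hδ1 : δ ≤ 1) (hP : 0 < P)
    (hg : P ≤ |g|) : s / (g ^ 2 + s) ≤ s ^ δ * P ^ (-(2 * δ)) := by
  have h1 : P ^ 2 ≤ g ^ 2 := by
    rw [← sq_abs g]; gcongr
  have h2 : s / (g ^ 2 + s) ≤ s / (P ^ 2 + s) := by gcongr
  refine h2.trans ?_
  have h3 : s ^ δ * P ^ (-(2 * δ)) = (s / P ^ 2) ^ δ := by
    rw [Real.div_rpow hs.le (by positivity), Real.rpow_neg hP.le, Real.rpow_mul hP.le,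
      Real.rpow_two]
    rfl
  rw [h3]
  rcases le_total (s / P ^ 2) 1 with h | h
  · calc s / (P ^ 2 + s) ≤ s / P ^ 2 := by gcongr; linarith
      _ = (s / P ^ 2) ^ (1 : ℝ) := (Real.rpow_one _).symm
      _ ≤ _ := Real.rpow_le_rpow_of_exponent_ge (by positivity) h hδ1
  · calc s / (P ^ 2 + s) ≤ 1 := by
          rw [div_le_one (by positivity)]; nlinarith [sq_nonneg P]
      _ ≤ _ := Real.one_le_rpow h hδ.le

theorem lintegral_abs_rpow_lt_top {κ : ℝ} (hκ : κ < 1) :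
    ∫⁻ t in Icc (-1 : ℝ) 1, ENNReal.ofReal (|t| ^ (-κ)) < ⊤ := by
  have h0 : IntegrableOn (fun t : ℝ => t ^ (-κ)) (Ioc 0 1) :=
    (intervalIntegral.intervalIntegrable_rpow' (by linarith)).1
  have h0' : IntegrableOn (fun t : ℝ => |t| ^ (-κ)) (Ioc 0 1) :=
    h0.congr_fun (fun t ht => by simp [abs_of_pos ht.1]) measurableSet_Ioc
  have h1 : IntegrableOn (fun t : ℝ => |t| ^ (-κ)) (Icc 0 1) :=
    (integrableOn_Icc_iff_integrableOn_Ioc (by simp)).2 h0'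
  have h2 : IntegrableOn (fun t : ℝ => |t| ^ (-κ)) (Icc (-1) 0) := by
    have := h1.comp_neg
    simpa using this
  have h3 := h2.union h1
  rw [Icc_union_Icc_eq_Icc (by norm_num) (by norm_num)] at h3
  exact h3.lintegral_lt_top

/-- Within distance `1` of `a` translation invariance gives the first term; farther away the
integrand is at most `1`. The bound does not involve `a`, as it must, since nothing is known about
where the roots lie. -/
theorem lintegral_abs_sub_rpow_le {κ : ℝ} (hκ : 0 ≤ κ) (a p q : ℝ) :
    ∫⁻ t in Icc p q, ENNReal.ofReal (|t - a| ^ (-κ)) ≤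
      (∫⁻ t in Icc (-1 : ℝ) 1, ENNReal.ofReal (|t| ^ (-κ))) + ENNReal.ofReal (q - p) := by
  set F : ℝ → ℝ≥0∞ := (Icc (-1 : ℝ) 1).indicator fun t => ENNReal.ofReal (|t| ^ (-κ)) with hF
  have hFm : Measurable F := by
    refine Measurable.indicator ?_ measurableSet_Icc
    fun_prop
  calc ∫⁻ t in Icc p q, ENNReal.ofReal (|t - a| ^ (-κ))
      ≤ ∫⁻ t in Icc p q, (F (t - a) + 1) := by
        refine lintegral_mono fun t => ?_
        by_cases h : t - a ∈ Icc (-1 : ℝ) 1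
        · simp [hF, indicator_of_mem h]
        · have h' : 1 ≤ |t - a| := by
            by_contra! hcon
            exact h (abs_le.1 hcon.le)
          calc ENNReal.ofReal (|t - a| ^ (-κ)) ≤ ENNReal.ofReal 1 :=
                ENNReal.ofReal_le_ofReal
                  (Real.rpow_le_one_of_one_le_of_nonpos h' (by linarith))
            _ ≤ _ := by simp
    _ = (∫⁻ t in Icc p q, F (t - a)) + ENNReal.ofReal (q - p) := by
        rw [lintegral_add_right _ measurable_const]
        simp
    _ ≤ (∫⁻ t, F (t - a)) + ENNReal.ofReal (q - p) := by
        gcongr ?_ + _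
        exact setLIntegral_le_lintegral _ _
    _ = _ := by
        rw [lintegral_sub_right_eq_self F a, hF, lintegral_indicator measurableSet_Icc]

/-- The polynomial lower bound is inserted into `s^δ P^(-2δ)` and integrated root by root. The
constant sees the functions only through `l`, and the interval only through the bound `ρ` on its
length. -/
theorem exists_lintegral_div_sq_add_le_line (k : ℕ) {δ l ρ : ℝ} (hδ : 0 < δ) (hδ1 : δ ≤ 1)
    (hk : 2 * (k : ℝ) * δ < 1) (hl : 0 < l) :
    ∃ C : ℝ≥0, ∀ p q : ℝ, p ≤ q → q - p ≤ ρ → ∀ G : ℕ → ℝ → ℝ,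
      (∀ j t, HasDerivAt (G j) (G (j + 1) t) t) → (∀ t ∈ Icc p q, l ≤ |G k t|) →
      ∀ s : ℝ, 0 < s →
      ∫⁻ t in Icc p q, ENNReal.ofReal (s / (G 0 t ^ 2 + s)) ≤ C * ENNReal.ofReal (s ^ δ) := by
  set κ : ℝ := 2 * k * δ
  set K : ℝ≥0∞ := ∫⁻ t in Icc (-1 : ℝ) 1, ENNReal.ofReal (|t| ^ (-κ)) with hK
  have hKt : K ≠ ⊤ := (lintegral_abs_rpow_lt_top hk).ne
  set A : ℝ := (l / k.factorial) ^ (-(2 * δ)) with hA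
  set C : ℝ≥0∞ := ENNReal.ofReal A * (ENNReal.ofReal ρ + k * (K + ENNReal.ofReal ρ)) with hC
  have hCt : C ≠ ⊤ := by
    refine ENNReal.mul_ne_top ENNReal.ofReal_ne_top ?_
    refine ENNReal.add_ne_top.2 ⟨ENNReal.ofReal_ne_top, ENNReal.mul_ne_top (by simp) ?_⟩
    exact ENNReal.add_ne_top.2 ⟨hKt, ENNReal.ofReal_ne_top⟩
  refine ⟨C.toNNReal, fun p q hpq hρ G hG h s hs => ?_⟩
  rw [ENNReal.coe_toNNReal hCt]
  obtain ⟨a, ha⟩ := exists_mul_prod_abs_sub_le hpq hG hl h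
  have hc : 0 < l / k.factorial := by positivity
  -- The roots are excluded because `0 ^ (-κ) = 0` for `κ ≠ 0`, so the right side is not large
  -- there; they form a null set.
  have hpt : ∀ t ∈ Icc p q, (∀ i, t ≠ a i) → ENNReal.ofReal (s / (G 0 t ^ 2 + s)) ≤
      ENNReal.ofReal (s ^ δ * A) * (1 + ∑ i, ENNReal.ofReal (|t - a i| ^ (-κ))) := by
    intro t ht hta
    have hx : ∀ i, 0 < |t - a i| := fun i => abs_pos.2 (sub_ne_zero.2 (hta i))
    have hP : 0 < ∏ i, |t - a i| := Finset.prod_pos fun i _ => hx i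
    have h1 := div_sq_add_le_rpow hs hδ hδ1 (mul_pos hc hP) (ha t ht)
    have h2 := prod_le_one_add_sum_pow (fun i => |t - a i| ^ (-(2 * δ)))
      fun i => Real.rpow_nonneg (abs_nonneg _) _
    have h3 : ∀ i, (|t - a i| ^ (-(2 * δ))) ^ k = |t - a i| ^ (-κ) := by
      intro i
      rw [← Real.rpow_natCast, ← Real.rpow_mul (abs_nonneg _)]
      congr 1
      simp only [κ]
      ring
    rw [Real.mul_rpow hc.le hP.le, ← Real.finsetProd_rpow _ _ fun i _ => abs_nonneg _] at h1
    simp only [h3] at h2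
    have hsA : 0 ≤ s ^ δ * A := by positivity
    have h4 : s / (G 0 t ^ 2 + s) ≤ s ^ δ * A * (1 + ∑ i, |t - a i| ^ (-κ)) := by
      refine h1.trans ?_
      rw [← mul_assoc]
      gcongr
    refine (ENNReal.ofReal_le_ofReal h4).trans ?_
    rw [ENNReal.ofReal_mul hsA, ENNReal.ofReal_add zero_le_one
      (Finset.sum_nonneg fun i _ => by positivity), ENNReal.ofReal_one,
      ENNReal.ofReal_sum_of_nonneg fun i _ => by positivity]
  have hae : ∀ᵐ t ∂(volume.restrict (Icc p q)), ENNReal.ofReal (s / (G 0 t ^ 2 + s)) ≤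
      ENNReal.ofReal (s ^ δ * A) * (1 + ∑ i, ENNReal.ofReal (|t - a i| ^ (-κ))) := by
    rw [ae_restrict_iff' measurableSet_Icc]
    have : ∀ᵐ t ∂(volume : Measure ℝ), ∀ i, t ≠ a i := by
      rw [ae_all_iff]
      intro i
      exact Measure.ae_ne volume (a i)
    filter_upwards [this] with t ht hmem using hpt t hmem ht
  calc ∫⁻ t in Icc p q, ENNReal.ofReal (s / (G 0 t ^ 2 + s))
      ≤ ∫⁻ t in Icc p q, ENNReal.ofReal (s ^ δ * A) *
          (1 + ∑ i, ENNReal.ofReal (|t - a i| ^ (-κ))) := lintegral_mono_ae hae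
    _ = ENNReal.ofReal (s ^ δ * A) * (ENNReal.ofReal (q - p) +
          ∑ i, ∫⁻ t in Icc p q, ENNReal.ofReal (|t - a i| ^ (-κ))) := by
        rw [lintegral_const_mul _ (by fun_prop), lintegral_add_left measurable_const,
          lintegral_finsetSum _ (fun i _ => by fun_prop)]
        simp
    _ ≤ ENNReal.ofReal (s ^ δ * A) * (ENNReal.ofReal ρ +
          ∑ _i : Fin k, (K + ENNReal.ofReal ρ)) := by
        gcongr with i
        exact (lintegral_abs_sub_rpow_le (by positivity) _ _ _).trans (by gcongr)
    _ = C * ENNReal.ofReal (s ^ δ) := by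
        rw [ENNReal.ofReal_mul (by positivity), hC]
        simp only [Finset.sum_const, Finset.card_univ, Fintype.card_fin, nsmul_eq_mul]
        ring

/-! ### Polarization of symmetric multilinear forms -/

/-- Polarization: the values of a symmetric multilinear form are controlled by those on the
diagonal. -/
theorem exists_sum_neg_one_pow_eq_mul {E : Type*} [AddCommGroup E] [Module ℝ E] {k : ℕ}
    (f : MultilinearMap ℝ (fun _ : Fin k => E) ℝ)
    (hf : ∀ (σ : Equiv.Perm (Fin k)) (v : Fin k → E), f (v ∘ σ) = f v) (v : Fin k → E) :
    ∃ N : ℕ, 1 ≤ N ∧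
      ∑ T : Finset (Fin k), (-1 : ℝ) ^ T.card * f (fun _ => ∑ i ∈ Tᶜ, v i) = N * f v := by
  classical
  -- Expanding each diagonal value gives a sum over maps `r` avoiding `T`. After exchanging the
  -- sums, the signs cancel over all `T` inside the complement of the image of `r`, unless `r` is
  -- surjective, hence a permutation; each permutation contributes `f v` by symmetry.
  refine ⟨(Finset.univ.filter fun r : Fin k → Fin k => Function.Surjective r).card,
    Finset.card_pos.2 ⟨id, by simp [Function.surjective_id]⟩, ?_⟩
  have h1 : ∀ T : Finset (Fin k), (-1 : ℝ) ^ T.card * f (fun _ => ∑ i ∈ Tᶜ, v i) =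
      ∑ r : Fin k → Fin k, if T ⊆ (Finset.univ.image r)ᶜ then
        (-1 : ℝ) ^ T.card * f (v ∘ r) else 0 := by
    intro T
    rw [f.map_sum_finset (fun _ i => v i) (fun _ => Tᶜ), Finset.mul_sum, ← Finset.sum_filter]
    refine Finset.sum_congr ?_ fun r _ => rfl
    ext r
    simp only [Fintype.mem_piFinset, Finset.mem_compl, Finset.mem_filter, Finset.mem_univ,
      true_and, Finset.subset_iff, Finset.mem_image, not_exists]
    constructor
    · rintro h x hx i rfl
      exact h i hx
    · intro h i hi
      exact h hi i rfl
  simp only [h1]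
  rw [Finset.sum_comm, Finset.card_filter, Nat.cast_sum, Finset.sum_mul]
  refine Finset.sum_congr rfl fun r _ => ?_
  rw [← Finset.sum_filter, ← Finset.sum_mul]
  have h2 : (Finset.univ.filter fun T : Finset (Fin k) => T ⊆ (Finset.univ.image r)ᶜ) =
      ((Finset.univ.image r)ᶜ).powerset := by
    ext T; simp
  have h3 : ∑ m ∈ ((Finset.univ.image r)ᶜ).powerset, (-1 : ℝ) ^ m.card =
      if (Finset.univ.image r)ᶜ = ∅ then 1 else 0 := by
    exact_mod_cast Finset.sum_powerset_neg_one_pow_card (x := (Finset.univ.image r)ᶜ)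
  rw [h2, h3]
  have h4 : (Finset.univ.image r)ᶜ = ∅ ↔ Function.Surjective r := by
    rw [Finset.compl_eq_empty_iff, Finset.eq_univ_iff_forall]
    simp [Function.Surjective]
  simp only [h4]
  split_ifs with h5
  · have := hf (Equiv.ofBijective r (Finite.surjective_iff_bijective.1 h5)) v
    simp only [Nat.cast_one]
    rw [one_mul, one_mul, ← this]
    rfl
  · simp

/-- Pigeonhole among the `2 ^ k` terms of the polarization identity, with `N ≥ 1`. Thus a mixed
derivative bounded below forces a pure one to be, in one of finitely many directions fixed in
advance. -/
theorem exists_le_abs_apply_sum {E : Type*} [AddCommGroup E] [Module ℝ E] {k : ℕ}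
    (f : MultilinearMap ℝ (fun _ : Fin k => E) ℝ)
    (hf : ∀ (σ : Equiv.Perm (Fin k)) (v : Fin k → E), f (v ∘ σ) = f v) (v : Fin k → E)
    {b : ℝ} (hb : b ≤ |f v|) :
    ∃ S : Finset (Fin k), b / 2 ^ k ≤ |f fun _ => ∑ i ∈ S, v i| := by
  obtain ⟨N, hN, h⟩ := exists_sum_neg_one_pow_eq_mul f hf v
  have h1 : |f v| ≤ ∑ T : Finset (Fin k), |f fun _ => ∑ i ∈ Tᶜ, v i| := by
    calc |f v| ≤ N * |f v| := le_mul_of_one_le_left (abs_nonneg _) (by exact_mod_cast hN)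
      _ = |N * f v| := by rw [abs_mul, Nat.abs_cast]
      _ ≤ ∑ T : Finset (Fin k), |(-1 : ℝ) ^ T.card * f fun _ => ∑ i ∈ Tᶜ, v i| := by
          rw [← h]; exact Finset.abs_sum_le_sum_abs _ _
      _ = _ := by simp [abs_mul]
  by_contra! hcon
  have h2 : ∑ T : Finset (Fin k), |f fun _ => ∑ i ∈ Tᶜ, v i| <
      ∑ _T : Finset (Fin k), b / 2 ^ k :=
    Finset.sum_lt_sum_of_nonempty Finset.univ_nonempty fun T _ => hcon Tᶜ
  simp only [Finset.sum_const, Finset.card_univ, Fintype.card_finset, Fintype.card_fin,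
    nsmul_eq_mul, Nat.cast_pow, Nat.cast_ofNat] at h2
  rw [mul_div_cancel₀ _ (by positivity)] at h2
  linarith

/-! ### Symmetry of higher derivatives and restriction to lines -/

section Symmetry

variable {E : Type*} [NormedAddCommGroup E] [NormedSpace ℝ E]

theorem _root_.ContDiff.differentiable_iteratedFDeriv_infty {F : Type*} [NormedAddCommGroup F]
    [NormedSpace ℝ F] {f : E → F} (hf : ContDiff ℝ ∞ f) (k : ℕ) :
    Differentiable ℝ (iteratedFDeriv ℝ k f) :=
  hf.differentiable_iteratedFDeriv (m := k) (by exact_mod_cast ENat.natCast_lt_top k)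

theorem _root_.ContDiff.contDiff_iteratedFDeriv_apply {f : E → ℝ}
    (hf : ContDiff ℝ ∞ f) (k : ℕ) (v : Fin k → E) :
    ContDiff ℝ ∞ fun x => iteratedFDeriv ℝ k f x v := by
  have h : ContDiff ℝ ∞ (iteratedFDeriv ℝ k f) :=
    hf.iteratedFDeriv_right (m := ∞) (by exact_mod_cast le_top)
  exact ((ContinuousMultilinearMap.apply ℝ (fun _ : Fin k => E) ℝ v).contDiff).comp h

theorem _root_.ContDiff.iteratedFDeriv_succ_apply {f : E → ℝ} (hf : ContDiff ℝ ∞ f) (k : ℕ)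
    (v : Fin (k + 1) → E) (x : E) :
    iteratedFDeriv ℝ (k + 1) f x v =
      fderiv ℝ (fun y => iteratedFDeriv ℝ k f y (Fin.tail v)) x (v 0) :=
  (hf.differentiable_iteratedFDeriv_infty k x).iteratedFDeriv_succ_apply_left'

/-- Adjacent transpositions generate the symmetric group. The one moving the first two slots is the
symmetry of the second derivative of a lower-order derivative; every other one fixes the outermost
slot and is handled by induction on the order. -/
theorem _root_.ContDiff.iteratedFDeriv_comp_perm {f : E → ℝ} (hf : ContDiff ℝ ∞ f) {k : ℕ}
    (σ : Equiv.Perm (Fin k)) (v : Fin k → E) (x : E) :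
    iteratedFDeriv ℝ k f x (v ∘ σ) = iteratedFDeriv ℝ k f x v := by
  induction k generalizing x with
  | zero => congr 1; ext i; exact i.elim0
  | succ k ih =>
    have hσ : σ ∈ Submonoid.closure
        (Set.range fun i : Fin k => Equiv.swap i.castSucc i.succ) := by
      rw [Equiv.Perm.mclosure_swap_castSucc_succ]; trivial
    induction hσ using Submonoid.closure_induction generalizing v with
    | one => rfl
    | mul σ τ _ _ h1 h2 =>
      have : v ∘ ⇑(σ * τ) = (v ∘ σ) ∘ τ := rfl
      rw [this, h2, h1]
    | mem σ h =>
      obtain ⟨i, rfl⟩ := h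
      rcases k with _ | k
      · exact i.elim0
      refine Fin.cases ?_ (fun i => ?_) i
      · set g : E → ℝ := fun y => iteratedFDeriv ℝ k f y (Fin.tail (Fin.tail v)) with hg
        have hgs : ContDiff ℝ ∞ g := hf.contDiff_iteratedFDeriv_apply k _
        have key : ∀ w : Fin (k + 2) → E, Fin.tail (Fin.tail w) = Fin.tail (Fin.tail v) →
            iteratedFDeriv ℝ (k + 2) f x w = fderiv ℝ (fderiv ℝ g) x (w 0) (w 1) := by
          intro w hw
          rw [hf.iteratedFDeriv_succ_apply]
          have h1 : (fun y => iteratedFDeriv ℝ (k + 1) f y (Fin.tail w)) =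
              fun y => fderiv ℝ g y (w 1) := by
            ext y
            rw [hf.iteratedFDeriv_succ_apply, hw]
            rfl
          have h2 : DifferentiableAt ℝ (fderiv ℝ g) x :=
            (hgs.fderiv_right (m := ∞) (by simp)).differentiable (by simp) x
          rw [h1, fderiv_clm_apply h2 (differentiableAt_const _)]
          simp
        rw [key v rfl, key]
        · have hsymm : IsSymmSndFDerivAt ℝ g x :=
            hgs.contDiffAt.isSymmSndFDerivAt (by
              rw [minSmoothness_of_isRCLikeNormedField]; exact WithTop.coe_le_coe.2 (le_top : (2 : ℕ∞) ≤ ⊤))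
          have e0 : (v ∘ ⇑(Equiv.swap (0 : Fin (k + 1)).castSucc (Fin.succ 0))) 0 = v 1 := by
            simp
          have e1 : (v ∘ ⇑(Equiv.swap (0 : Fin (k + 1)).castSucc (Fin.succ 0))) 1 = v 0 := by
            simp
          rw [e0, e1]
          exact hsymm.eq _ _
        · ext j
          simp only [Fin.tail, Function.comp_apply]
          rw [Equiv.swap_apply_of_ne_of_ne]
          · simp
          · exact fun h => by simpa using (Fin.succ_injective _ h)
      · have h0 : (v ∘ ⇑(Equiv.swap i.succ.castSucc i.succ.succ)) 0 = v 0 := by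
          simp only [Function.comp_apply]
          rw [Equiv.swap_apply_of_ne_of_ne] <;> simp [Fin.ext_iff]
        have h1 : Fin.tail (v ∘ ⇑(Equiv.swap i.succ.castSucc i.succ.succ)) =
            Fin.tail v ∘ ⇑(Equiv.swap i.castSucc i.succ) := by
          ext j
          simp only [Fin.tail, Function.comp_apply]
          congr 1
          rw [← Fin.succ_castSucc, (Fin.succ_injective (k + 1)).swap_apply]
        rw [hf.iteratedFDeriv_succ_apply, h0, h1, hf.iteratedFDeriv_succ_apply]
        have h2 := fun y => ih (Equiv.swap i.castSucc i.succ) (Fin.tail v) y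
        simp only [h2]

/-- Derivatives along a line. -/
theorem _root_.ContDiff.hasDerivAt_iteratedFDeriv_line {f : E → ℝ} (hf : ContDiff ℝ ∞ f) (x w : E)
    (j : ℕ) (t : ℝ) :
    HasDerivAt (fun t : ℝ => iteratedFDeriv ℝ j f (x + t • w) fun _ => w)
      (iteratedFDeriv ℝ (j + 1) f (x + t • w) fun _ => w) t := by
  have h1 : HasDerivAt (fun t : ℝ => x + t • w) w t := by
    simpa using ((hasDerivAt_id t).smul_const w).const_add x
  have h2 : HasFDerivAt (fun y => iteratedFDeriv ℝ j f y fun _ => w) _ (x + t • w) :=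
    ((hf.contDiff_iteratedFDeriv_apply j fun _ => w).differentiable (by simp) _).hasFDerivAt
  have h3 := h2.comp_hasDerivAt t h1
  refine h3.congr_deriv ?_
  rw [hf.iteratedFDeriv_succ_apply]
  rfl

end Symmetry

/-! ### The integral of `s / (J² + s)` on a ball -/

variable {d : ℕ}

/-- Polarization covers the ball by finitely many sets `A S`, on each of which the `k`-th derivative
along `dir S` is large. It stays large along short segments parallel to `dir S`, where the
one-variable bound applies; averaging over translations along the segment and Tonelli give the
integral over `A S`. The directions need not be normalized. -/
theorem exists_lintegral_div_sq_add_le (d k : ℕ) {δ b : ℝ} (M' R₀ : ℝ) (hδ : 0 < δ) (hδ1 : δ ≤ 1)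
    (hk : 2 * (k : ℝ) * δ < 1) (hb : 0 < b) :
    ∃ C : ℝ≥0, ∀ (c : Euc d) (r : ℝ) (J : Euc d → ℝ) (v : Fin k → Euc d), r ≤ R₀ →
      ContDiff ℝ ∞ J → (∀ i, ‖v i‖ ≤ 1) →
      (∀ τ ∈ closedBall c r, b ≤ |iteratedFDeriv ℝ k J τ v|) →
      (∀ τ ∈ closedBall c r, ‖iteratedFDeriv ℝ (k + 1) J τ‖ ≤ M') →
      ∀ s : ℝ, 0 < s →
        ∫⁻ τ in closedBall c r, ENNReal.ofReal (s / (J τ ^ 2 + s)) ≤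
          C * ENNReal.ofReal (s ^ δ) := by
  -- Polarization gives `2 * l`; one `l` may be lost along a segment. There the `k`-th derivative
  -- has slope at most `M₁`, as `‖dir S‖ ≤ k`, and `ρ` is chosen so that `M₁ * ρ ≤ l`.
  set l : ℝ := b / 2 ^ (k + 1) with hl
  have hl0 : 0 < l := by positivity
  set M₁ : ℝ := max M' 0 * (k : ℝ) ^ (k + 1) with hM₁
  have hM₁0 : 0 ≤ M₁ := by positivity
  set ρ : ℝ := l / (M₁ + 1) with hρ
  have hρ0 : 0 < ρ := by positivity
  obtain ⟨C₁, hC₁⟩ := exists_lintegral_div_sq_add_le_line k (ρ := ρ) hδ hδ1 hk hl0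
  -- The starting point of a segment that meets the ball lies within `ρ * k` of it.
  set V : ℝ≥0∞ := volume (closedBall (0 : Euc d) (R₀ + ρ * k)) with hV
  have hVt : V ≠ ⊤ := measure_closedBall_lt_top.ne
  set C : ℝ≥0∞ := 2 ^ k * ((ENNReal.ofReal ρ)⁻¹ * (C₁ * V)) with hC
  have hCt : C ≠ ⊤ := by
    refine ENNReal.mul_ne_top (by simp) (ENNReal.mul_ne_top ?_ ?_)
    · simpa using hρ0
    · exact ENNReal.mul_ne_top (by simp) hVt
  refine ⟨C.toNNReal, fun c r J v hr hJ hv hbd hM s hs => ?_⟩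
  rw [ENNReal.coe_toNNReal hCt]
  set F : Euc d → ℝ≥0∞ := fun τ => ENNReal.ofReal (s / (J τ ^ 2 + s)) with hF
  have hFm : Measurable F := by
    have := hJ.continuous.measurable
    fun_prop
  set dir : Finset (Fin k) → Euc d := fun S => ∑ i ∈ S, v i with hdir
  have hdirn : ∀ S, ‖dir S‖ ≤ k := fun S => by
    calc ‖dir S‖ ≤ ∑ i ∈ S, ‖v i‖ := norm_sum_le _ _
      _ ≤ ∑ i ∈ S, (1 : ℝ) := Finset.sum_le_sum fun i _ => hv i
      _ = S.card := by simp
      _ ≤ k := by exact_mod_cast (card_finset_fin_le S)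
  set A : Finset (Fin k) → Set (Euc d) := fun S =>
    closedBall c r ∩ {τ | 2 * l ≤ |iteratedFDeriv ℝ k J τ fun _ => dir S|} with hA
  have hAm : ∀ S, MeasurableSet (A S) := fun S => by
    refine (isClosed_closedBall.inter ?_).measurableSet
    exact isClosed_le continuous_const (hJ.contDiff_iteratedFDeriv_apply k _).continuous.abs
  have hcov : closedBall c r ⊆ ⋃ S, A S := by
    intro τ hτ
    obtain ⟨S, hS⟩ := exists_le_abs_apply_sum (iteratedFDeriv ℝ k J τ).toMultilinearMap
      (fun σ v => hJ.iteratedFDeriv_comp_perm σ v τ) v (hbd τ hτ)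
    refine mem_iUnion.2 ⟨S, hτ, ?_⟩
    have : 2 * l = b / 2 ^ k := by rw [hl, pow_succ]; field_simp
    rw [mem_ofPred_eq, this]
    exact hS
  have hline : ∀ S x, ∫⁻ t in Icc 0 ρ, (A S).indicator F (x + t • dir S) ≤
      (closedBall c (R₀ + ρ * k)).indicator
        (fun _ => C₁ * ENNReal.ofReal (s ^ δ)) x := by
    intro S x
    by_cases hex : ∃ t₀ ∈ Icc 0 ρ, x + t₀ • dir S ∈ A S
    swap
    · push Not at hex
      rw [setLIntegral_congr_fun (g := fun _ => 0) measurableSet_Icc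
        (fun t ht => indicator_of_notMem (hex t ht) _)]
      simp
    obtain ⟨t₀, ht₀, hA₀⟩ := hex
    have hx : x ∈ closedBall c (R₀ + ρ * k) := by
      have h1 : dist (x + t₀ • dir S) c ≤ r := hA₀.1
      have h2 : dist x (x + t₀ • dir S) ≤ ρ * k := by
        rw [dist_self_add_right, norm_smul, Real.norm_eq_abs, abs_of_nonneg ht₀.1]
        exact mul_le_mul ht₀.2 (hdirn S) (norm_nonneg _) hρ0.le
      rw [mem_closedBall]
      linarith [dist_triangle x (x + t₀ • dir S) c]
    rw [indicator_of_mem hx]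
    -- The derivative bounds hold only inside the ball. By convexity the segment meets it in a
    -- compact interval, to which the one-variable estimate is applied.
    set T : Set ℝ := Icc 0 ρ ∩ (fun t : ℝ => x + t • dir S) ⁻¹' closedBall c r with hT
    have hTcont : Continuous fun t : ℝ => x + t • dir S := by fun_prop
    have hTc : IsCompact T :=
      isCompact_Icc.inter_right (isClosed_closedBall.preimage hTcont)
    have hTconv : Convex ℝ T := by
      refine (convex_Icc 0 ρ).inter ?_
      have : (fun t : ℝ => x + t • dir S) = AffineMap.lineMap x (x + dir S) := by
        ext1 t; simp [AffineMap.lineMap_apply, add_comm]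
      rw [this]
      exact (convex_closedBall c r).affine_preimage _
    have ht₀T : t₀ ∈ T := ⟨ht₀, hA₀.1⟩
    have hTI := eq_Icc_of_connected_compact ⟨⟨t₀, ht₀T⟩, hTconv.isPreconnected⟩ hTc
    set p := sInf T
    set q := sSup T
    have hpq : p ≤ q := by
      rw [hTI] at ht₀T; exact ht₀T.1.trans ht₀T.2
    have hp : p ∈ T := by rw [hTI]; exact left_mem_Icc.2 hpq
    have hq : q ∈ T := by rw [hTI]; exact right_mem_Icc.2 hpq
    have hGd := hJ.hasDerivAt_iteratedFDeriv_line x (dir S)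
    have hGk : ∀ t ∈ Icc p q, l ≤ |iteratedFDeriv ℝ k J (x + t • dir S) fun _ => dir S| := by
      rw [← hTI]
      intro t ht
      have h1 : ‖(iteratedFDeriv ℝ k J (x + t • dir S) fun _ => dir S) -
          (iteratedFDeriv ℝ k J (x + t₀ • dir S) fun _ => dir S)‖ ≤ M₁ * ‖t - t₀‖ := by
        refine hTconv.norm_image_sub_le_of_norm_hasDerivWithin_le
          (f := fun t => iteratedFDeriv ℝ k J (x + t • dir S) fun _ => dir S)
          (fun u _ => (hGd k u).hasDerivWithinAt) (fun u hu => ?_) ht₀T ht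
        refine ((iteratedFDeriv ℝ (k + 1) J (x + u • dir S)).le_opNorm _).trans ?_
        rw [Finset.prod_const, Finset.card_univ, Fintype.card_fin, hM₁]
        gcongr
        · exact (hM _ hu.2).trans (le_max_left _ _)
        · exact hdirn S
      have h2 : ‖t - t₀‖ ≤ ρ := by
        rw [Real.norm_eq_abs, abs_le]
        have := ht.1.1; have := ht.1.2; have := ht₀.1; have := ht₀.2
        constructor <;> linarith
      have h3 : M₁ * ‖t - t₀‖ ≤ l := by
        calc M₁ * ‖t - t₀‖ ≤ (M₁ + 1) * ρ := by gcongr; linarith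
          _ = l := by rw [hρ]; field_simp
      have h4 : 2 * l ≤ |iteratedFDeriv ℝ k J (x + t₀ • dir S) fun _ => dir S| := hA₀.2
      have h5 := abs_sub_abs_le_abs_sub (iteratedFDeriv ℝ k J (x + t₀ • dir S) fun _ => dir S)
        (iteratedFDeriv ℝ k J (x + t • dir S) fun _ => dir S)
      rw [abs_sub_comm] at h5
      rw [Real.norm_eq_abs] at h1
      linarith
    have h6 := hC₁ p q hpq (by have := hq.1.2; have := hp.1.1; linarith) _ hGd hGk s hs
    refine le_trans ?_ h6
    rw [← hTI]
    calc ∫⁻ t in Icc 0 ρ, (A S).indicator F (x + t • dir S)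
        ≤ ∫⁻ t in Icc 0 ρ, ((fun t : ℝ => x + t • dir S) ⁻¹' closedBall c r).indicator
            (fun t => F (x + t • dir S)) t := by
          refine lintegral_mono fun t => ?_
          by_cases h : x + t • dir S ∈ A S
          · rw [indicator_of_mem h, indicator_of_mem
              (show t ∈ (fun t : ℝ => x + t • dir S) ⁻¹' closedBall c r from h.1)]
          · rw [indicator_of_notMem h]; exact zero_le
      _ = ∫⁻ t in T, F (x + t • dir S) := by
          rw [setLIntegral_indicator (isClosed_closedBall.preimage hTcont).measurableSet,
            inter_comm]
      _ = _ := by simp [hF]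
  have hdir : ∀ S, ∫⁻ τ in A S, F τ ≤
      (ENNReal.ofReal ρ)⁻¹ * (C₁ * V) * ENNReal.ofReal (s ^ δ) := by
    intro S
    have hGm : Measurable ((A S).indicator F) := hFm.indicator (hAm S)
    -- The inner integral does not depend on `t`, by translation invariance.
    have h1 : ENNReal.ofReal ρ * ∫⁻ τ in A S, F τ =
        ∫⁻ t in Icc 0 ρ, ∫⁻ x, (A S).indicator F (x + t • dir S) := by
      simp_rw [lintegral_add_right_eq_self ((A S).indicator F), lintegral_indicator (hAm S)]
      rw [lintegral_const, Measure.restrict_apply_univ, Real.volume_Icc, sub_zero, mul_comm]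
    have h2 : ∫⁻ t in Icc 0 ρ, ∫⁻ x, (A S).indicator F (x + t • dir S) =
        ∫⁻ x, ∫⁻ t in Icc 0 ρ, (A S).indicator F (x + t • dir S) := by
      apply lintegral_lintegral_swap
      apply Measurable.aemeasurable
      apply hGm.comp
      fun_prop
    have h3 : ∫⁻ x, ∫⁻ t in Icc 0 ρ, (A S).indicator F (x + t • dir S) ≤
        C₁ * ENNReal.ofReal (s ^ δ) * V := by
      refine (lintegral_mono (hline S)).trans ?_
      rw [lintegral_indicator measurableSet_closedBall, lintegral_const,
        Measure.restrict_apply_univ, hV, Measure.addHaar_closedBall_center]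
    rw [mul_assoc, ← ENNReal.div_eq_inv_mul, ENNReal.le_div_iff_mul_le (by simp [hρ0]) (by simp),
      mul_comm, h1, h2]
    refine h3.trans (le_of_eq ?_)
    ring
  calc ∫⁻ τ in closedBall c r, F τ
      ≤ ∫⁻ τ in ⋃ S, A S, F τ :=
        lintegral_mono_set hcov
    _ ≤ ∑ S : Finset (Fin k), ∫⁻ τ in A S, F τ := 
        (lintegral_iUnion_le _ _).trans (tsum_fintype _).le
    _ ≤ ∑ _S : Finset (Fin k), (ENNReal.ofReal ρ)⁻¹ * (C₁ * V) * ENNReal.ofReal (s ^ δ) :=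
        Finset.sum_le_sum fun S _ => hdir S
    _ = C * ENNReal.ofReal (s ^ δ) := by
        rw [hC]
        simp only [Finset.sum_const, Finset.card_univ, Fintype.card_finset, Fintype.card_fin,
          nsmul_eq_mul, Nat.cast_pow, Nat.cast_ofNat]
        ring

/-! ### The determinant form and Cramer's rule -/

/-- The determinant of `n` vectors of `ℝ^n`, as an alternating form. -/
def detAlternating (n : ℕ) : (Euc n) [⋀^Fin n]→ₗ[ℝ] ℝ :=
  (Matrix.detRowAlternating (R := ℝ) (n := Fin n)).compLinearMap
    (WithLp.linearEquiv 2 ℝ (Fin n → ℝ)).toLinearMap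

/-- The determinant of `n` vectors of `ℝ^n`, as a continuous multilinear form. -/
def detForm (n : ℕ) : ContinuousMultilinearMap ℝ (fun _ : Fin n => Euc n) ℝ where
  toMultilinearMap := (detAlternating n).toMultilinearMap
  cont := by
    have : Continuous fun w : Fin n → Euc n => (Matrix.of fun i j => w i j).det := by
      apply Continuous.matrix_det
      fun_prop
    exact this

theorem detForm_eq_det {n : ℕ} (w : Fin n → Euc n) :
    detForm n w = (Matrix.of fun i j => w j i : Matrix (Fin n) (Fin n) ℝ).det := by
  rw [← Matrix.det_transpose]
  rfl

theorem detForm_swap {n : ℕ} (w : Fin n → Euc n) {i j : Fin n} (hij : i ≠ j) :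
    detForm n (w ∘ Equiv.swap i j) = -detForm n w :=
  (detAlternating n).map_swap w hij

/-- Cramer's rule in its adjugate form, valid also where the determinant vanishes, which is exactly
where the Jacobian minor is delicate. -/
theorem detForm_smul_eq_sum {n : ℕ} (w : Fin n → Euc n) (z : Euc n) :
    detForm n w • z = ∑ i, detForm n (Function.update w i z) • w i := by
  set A : Matrix (Fin n) (Fin n) ℝ := Matrix.of fun i j => w j i with hA
  have h := Matrix.mulVec_cramer A (fun i => z i)
  have h1 : ∀ i, A.cramer (fun i => z i) i = detForm n (Function.update w i z) := by
    intro i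
    rw [Matrix.cramer_apply, detForm_eq_det]
    congr 1
    ext a b
    by_cases hb : b = i
    · subst hb; simp
    · simp [hb, hA]
  ext a
  have h2 := congrFun h a
  rw [Matrix.mulVec, dotProduct] at h2
  simp only [h1, Pi.smul_apply] at h2
  rw [detForm_eq_det, PiLp.smul_apply, ← hA, ← h2]
  simp [hA, mul_comm]

theorem abs_detForm_le {n : ℕ} (w : Fin n → Euc n) {M : ℝ} (i : Fin n) (hM : 1 ≤ M)
    (h : ∀ j, j ≠ i → ‖w j‖ ≤ M) : |detForm n w| ≤ ‖detForm n‖ * (M ^ n * ‖w i‖) := by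
  refine ((detForm n).le_opNorm w).trans ?_
  gcongr
  rw [← Finset.mul_prod_erase _ _ (Finset.mem_univ i), mul_comm]
  gcongr
  calc ∏ j ∈ Finset.univ.erase i, ‖w j‖ ≤ ∏ j ∈ Finset.univ.erase i, M :=
        Finset.prod_le_prod (fun _ _ => norm_nonneg _) fun j hj => h j (Finset.ne_of_mem_erase hj)
    _ = M ^ (n - 1) := by simp
    _ ≤ M ^ n := pow_le_pow_right₀ hM (Nat.sub_le _ _)

/-! ### Jacobian minors: derivatives, divergence form and bounds -/

section Derivatives

variable {n d : ℕ}

theorem hasFDerivAt_detForm {w : Fin n → Euc d → Euc n} {x : Euc d}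
    {w' : Fin n → Euc d →L[ℝ] Euc n} (hw : ∀ i, HasFDerivAt (w i) (w' i) x) :
    HasFDerivAt (fun x => detForm n fun i => w i x)
      (∑ i, (detForm n).toContinuousLinearMap (fun i => w i x) i ∘L w' i) x :=
  HasFDerivAt.multilinear_comp (f := detForm n) (g := w) hw

theorem contDiff_detForm {m : ℕ∞} {w : Fin n → Euc d → Euc n} (hw : ∀ i, ContDiff ℝ m (w i)) :
    ContDiff ℝ m fun x => detForm n fun i => w i x :=
  (detForm n).contDiff.comp (contDiff_pi.2 hw)

theorem fderiv_detForm {w : Fin n → Euc d → Euc n} {x : Euc d}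
    (hw : ∀ i, DifferentiableAt ℝ (w i) x) (v : Euc d) :
    fderiv ℝ (fun x => detForm n fun i => w i x) x v =
      ∑ i, detForm n (Function.update (fun i => w i x) i (fderiv ℝ (w i) x v)) := by
  rw [(hasFDerivAt_detForm fun i => (hw i).hasFDerivAt).fderiv]
  simp [ContinuousMultilinearMap.toContinuousLinearMap_apply]

/-- The columns of index `e i` of the Jacobian matrix. -/
def jacobianColumn (Φ : Euc d → Euc n) (e : Fin n → Fin d) (i : Fin n) (x : Euc d) : Euc n :=
  fderiv ℝ Φ x (EuclideanSpace.single (e i) 1)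

/-- The minor of the Jacobian matrix formed by the columns `e i`. -/
def minor (Φ : Euc d → Euc n) (e : Fin n → Fin d) (x : Euc d) : ℝ :=
  detForm n fun i => jacobianColumn Φ e i x

variable {Φ : Euc d → Euc n}

theorem contDiff_jacobianColumn (hΦ : ContDiff ℝ ∞ Φ) (e : Fin n → Fin d) (i : Fin n) :
    ContDiff ℝ ∞ (jacobianColumn Φ e i) :=
  (hΦ.fderiv_right (m := ∞) (by simp)).clm_apply contDiff_const

theorem contDiff_minor (hΦ : ContDiff ℝ ∞ Φ) (e : Fin n → Fin d) : ContDiff ℝ ∞ (minor Φ e) :=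
  contDiff_detForm fun i => contDiff_jacobianColumn hΦ e i

theorem fderiv_jacobianColumn_symm (hΦ : ContDiff ℝ ∞ Φ) (e : Fin n → Fin d) (i j : Fin n)
    (x : Euc d) :
    fderiv ℝ (jacobianColumn Φ e i) x (EuclideanSpace.single (e j) 1) =
      fderiv ℝ (jacobianColumn Φ e j) x (EuclideanSpace.single (e i) 1) := by
  have h2 : DifferentiableAt ℝ (fderiv ℝ Φ) x :=
    (hΦ.fderiv_right (m := ∞) (by simp)).differentiable (by simp) x
  have key : ∀ i v, fderiv ℝ (jacobianColumn Φ e i) x v =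
      fderiv ℝ (fderiv ℝ Φ) x v (EuclideanSpace.single (e i) 1) := by
    intro i v
    unfold jacobianColumn
    rw [fderiv_clm_apply h2 (differentiableAt_const _)]
    simp
  have hsymm : IsSymmSndFDerivAt ℝ Φ x := hΦ.contDiffAt.isSymmSndFDerivAt (by
    rw [minSmoothness_of_isRCLikeNormedField]; exact WithTop.coe_le_coe.2 (le_top : (2 : ℕ∞) ≤ ⊤))
  rw [key, key, hsymm.eq]

/-- The Jacobian columns with the `i`-th one replaced by `u`. -/
def replacedColumns (Φ : Euc d → Euc n) (e : Fin n → Fin d) (i : Fin n) (u : Euc d → Euc n)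
    (j : Fin n) : Euc d → Euc n :=
  if j = i then u else jacobianColumn Φ e j

/-- The minor with the `i`-th column replaced by `u`. -/
def replacedMinor (Φ : Euc d → Euc n) (e : Fin n → Fin d) (i : Fin n) (u : Euc d → Euc n)
    (x : Euc d) : ℝ :=
  detForm n fun j => replacedColumns Φ e i u j x

theorem contDiff_replacedColumns (hΦ : ContDiff ℝ ∞ Φ) (e : Fin n → Fin d) (i : Fin n)
    {u : Euc d → Euc n} (hu : ContDiff ℝ ∞ u) (j : Fin n) :
    ContDiff ℝ ∞ (replacedColumns Φ e i u j) := by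
  unfold replacedColumns
  split_ifs
  exacts [hu, contDiff_jacobianColumn hΦ e j]

theorem contDiff_replacedMinor (hΦ : ContDiff ℝ ∞ Φ) (e : Fin n → Fin d) (i : Fin n)
    {u : Euc d → Euc n} (hu : ContDiff ℝ ∞ u) : ContDiff ℝ ∞ (replacedMinor Φ e i u) :=
  contDiff_detForm fun j => contDiff_replacedColumns hΦ e i hu j

theorem replacedColumns_apply (e : Fin n → Fin d) (i : Fin n) (u : Euc d → Euc n) (x : Euc d) :
    (fun j => replacedColumns Φ e i u j x) =
      Function.update (fun j => jacobianColumn Φ e j x) i (u x) := by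
  ext1 j
  by_cases h : j = i
  · subst h; simp [replacedColumns]
  · simp [replacedColumns, h]

/-- Every Jacobian minor is a divergence. -/
theorem sum_fderiv_replacedMinor (hΦ : ContDiff ℝ ∞ Φ) (e : Fin n → Fin d) (x : Euc d) :
    ∑ i, fderiv ℝ (replacedMinor Φ e i Φ) x (EuclideanSpace.single (e i) 1) =
      n * minor Φ e x := by
  -- The terms in which a column other than the replaced one is differentiated. Differentiating the
  -- replaced column `Φ` itself restores the minor, once for each `i`.
  set a : Fin n → Fin n → ℝ := fun i j =>
    if j = i then 0 else detForm n (Function.update (Function.update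
      (fun j => jacobianColumn Φ e j x) i (Φ x)) j
        (fderiv ℝ (jacobianColumn Φ e j) x (EuclideanSpace.single (e i) 1))) with ha
  have h1 : ∀ i, fderiv ℝ (replacedMinor Φ e i Φ) x (EuclideanSpace.single (e i) 1) =
      minor Φ e x + ∑ j, a i j := by
    intro i
    unfold replacedMinor
    rw [fderiv_detForm (fun j =>
      (contDiff_replacedColumns hΦ e i hΦ j).differentiable (by simp) x),
      replacedColumns_apply, ← Finset.add_sum_erase _ _ (Finset.mem_univ i),
      ← Finset.add_sum_erase (Finset.univ) (a i) (Finset.mem_univ i)]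
    have h0 : a i i = 0 := by simp [ha]
    rw [h0, zero_add]
    congr 1
    · rw [Function.update_idem]
      have : fderiv ℝ (replacedColumns Φ e i Φ i) x (EuclideanSpace.single (e i) 1) =
          jacobianColumn Φ e i x := by simp [replacedColumns, jacobianColumn]
      rw [this, Function.update_eq_self]
      rfl
    · refine Finset.sum_congr rfl fun j hj => ?_
      have hji := Finset.ne_of_mem_erase hj
      simp [ha, hji, replacedColumns]
  -- By symmetry of second derivatives the two determinants have the same columns, with `i` and `j`
  -- exchanged.
  have h2 : ∀ i j, a j i = -a i j := by
    intro i j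
    by_cases hij : i = j
    · simp [ha, hij]
    · have hji : j ≠ i := fun h => hij h.symm
      simp only [ha, if_neg hij, if_neg hji]
      rw [← detForm_swap _ hij, fderiv_jacobianColumn_symm hΦ]
      congr 1
      ext1 m
      simp only [Function.comp_apply]
      by_cases hmi : m = i
      · subst hmi; simp
      · by_cases hmj : m = j
        · subst hmj; simp [hmi, hij]
        · rw [Equiv.swap_apply_of_ne_of_ne hmi hmj]
          simp [hmi, hmj]
  have h3 : ∑ i, ∑ j, a i j = 0 := by
    have h4 : ∑ i, ∑ j, a i j = -∑ i, ∑ j, a i j := by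
      conv_lhs => rw [Finset.sum_comm]
      rw [← Finset.sum_neg_distrib]
      refine Finset.sum_congr rfl fun i _ => ?_
      rw [← Finset.sum_neg_distrib]
      exact Finset.sum_congr rfl fun j _ => h2 i j
    linarith
  simp only [h1, Finset.sum_add_distrib, h3, add_zero]
  simp

theorem minor_smul_eq_sum (e : Fin n → Fin d) (z : Euc n) (x : Euc d) :
    minor Φ e x • z = ∑ i, replacedMinor Φ e i (fun _ => z) x • jacobianColumn Φ e i x := by
  unfold minor replacedMinor
  rw [detForm_smul_eq_sum]
  simp only [replacedColumns_apply]

theorem norm_jacobianColumn_le (e : Fin n → Fin d) (i : Fin n) {x : Euc d} {M : ℝ}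
    (h : ‖fderiv ℝ Φ x‖ ≤ M) : ‖jacobianColumn Φ e i x‖ ≤ M := by
  refine ((fderiv ℝ Φ x).le_opNorm _).trans ?_
  simpa using h

theorem norm_fderiv_jacobianColumn_le (hΦ : ContDiff ℝ ∞ Φ) (e : Fin n → Fin d) (i j : Fin n)
    {x : Euc d} {M : ℝ} (h : ‖fderiv ℝ (fderiv ℝ Φ) x‖ ≤ M) :
    ‖fderiv ℝ (jacobianColumn Φ e i) x (EuclideanSpace.single (e j) 1)‖ ≤ M := by
  have h2 : DifferentiableAt ℝ (fderiv ℝ Φ) x :=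
    (hΦ.fderiv_right (m := ∞) (by simp)).differentiable (by simp) x
  unfold jacobianColumn
  rw [fderiv_clm_apply h2 (differentiableAt_const _)]
  simp only [fderiv_fun_const, Pi.zero_apply, ContinuousLinearMap.comp_zero, zero_add,
    ContinuousLinearMap.flip_apply]
  refine (ContinuousLinearMap.le_opNorm₂ _ _ _).trans ?_
  simpa using h

theorem abs_replacedMinor_le (e : Fin n → Fin d) (i : Fin n) (u : Euc d → Euc n)
    {x : Euc d} {M : ℝ} (hM : 1 ≤ M) (h : ‖fderiv ℝ Φ x‖ ≤ M) :
    |replacedMinor Φ e i u x| ≤ ‖detForm n‖ * (M ^ n * ‖u x‖) := by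
  unfold replacedMinor
  rw [replacedColumns_apply]
  refine (abs_detForm_le _ i hM fun j hj => ?_).trans ?_
  · simpa [hj] using norm_jacobianColumn_le e j h
  · simp

theorem abs_minor_le (e : Fin n → Fin d) {x : Euc d} {M : ℝ} (h : ‖fderiv ℝ Φ x‖ ≤ M) :
    |minor Φ e x| ≤ ‖detForm n‖ * M ^ n := by
  refine ((detForm n).le_opNorm _).trans ?_
  gcongr
  calc ∏ j, ‖jacobianColumn Φ e j x‖ ≤ ∏ _j : Fin n, M :=
        Finset.prod_le_prod (fun _ _ => norm_nonneg _) fun j _ => norm_jacobianColumn_le e j h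
    _ = M ^ n := by simp

theorem abs_fderiv_minor_le (hΦ : ContDiff ℝ ∞ Φ) (e : Fin n → Fin d) (m : Fin n)
    {x : Euc d} {M : ℝ} (hM : 1 ≤ M) (h : ‖fderiv ℝ Φ x‖ ≤ M)
    (h' : ‖fderiv ℝ (fderiv ℝ Φ) x‖ ≤ M) :
    |fderiv ℝ (minor Φ e) x (EuclideanSpace.single (e m) 1)| ≤
      n * (‖detForm n‖ * (M ^ n * M)) := by
  unfold minor
  rw [fderiv_detForm fun j => (contDiff_jacobianColumn hΦ e j).differentiable (by simp) x]
  refine (Finset.abs_sum_le_sum_abs _ _).trans ?_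
  calc _ ≤ ∑ _i : Fin n, ‖detForm n‖ * (M ^ n * M) := by
        refine Finset.sum_le_sum fun i _ => ?_
        refine (abs_detForm_le _ i hM fun j hj => ?_).trans ?_
        · simpa [hj] using norm_jacobianColumn_le e j h
        · gcongr
          simpa using norm_fderiv_jacobianColumn_le hΦ e i m h'
    _ = _ := by simp

theorem abs_fderiv_replacedMinor_le (hΦ : ContDiff ℝ ∞ Φ) (e : Fin n → Fin d) (i m : Fin n)
    (z : Euc n) {x : Euc d} {M : ℝ} (hM : 1 ≤ M) (h : ‖fderiv ℝ Φ x‖ ≤ M)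
    (h' : ‖fderiv ℝ (fderiv ℝ Φ) x‖ ≤ M) :
    |fderiv ℝ (replacedMinor Φ e i fun _ => z) x (EuclideanSpace.single (e m) 1)| ≤
      n * (‖detForm n‖ * (M ^ n * ‖z‖)) := by
  unfold replacedMinor
  rw [fderiv_detForm fun j =>
    (contDiff_replacedColumns hΦ e i contDiff_const j).differentiable (by simp) x,
    replacedColumns_apply]
  refine (Finset.abs_sum_le_sum_abs _ _).trans ?_
  calc _ ≤ ∑ _i : Fin n, ‖detForm n‖ * (M ^ n * ‖z‖) := by
        refine Finset.sum_le_sum fun j _ => ?_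
        by_cases hji : j = i
        · subst hji
          have h0 : fderiv ℝ (replacedColumns Φ e j (fun _ => z) j) x
              (EuclideanSpace.single (e m) 1) = 0 := by
            simp [replacedColumns]
          rw [h0, (detForm n).map_coord_zero j (by simp), abs_zero]
          positivity
        · refine (abs_detForm_le _ i hM fun l hl => ?_).trans ?_
          · by_cases hlj : l = j
            · subst hlj
              simpa [replacedColumns, hl] using norm_fderiv_jacobianColumn_le hΦ e l m h'
            · simpa [hl, hlj] using norm_jacobianColumn_le e l h
          · have hij : i ≠ j := fun h => hji h.symm
            simp [hij]
    _ = _ := by simp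

end Derivatives

/-! ### Integration by parts against rescaled cutoffs -/

/-- A coordinate vector. -/
abbrev coordVec {d : ℕ} (i : Fin d) : Euc d := EuclideanSpace.single i 1

section IntegrationByParts

variable {d : ℕ}

theorem integral_mul_fderiv_eq_neg {u g : Euc d → ℝ} (hu : ContDiff ℝ 1 u)
    (hg : ContDiff ℝ 1 g) (hc : HasCompactSupport u) (v : Euc d) :
    ∫ x, u x * fderiv ℝ g x v = -∫ x, fderiv ℝ u x v * g x := by
  have hu' : Continuous fun x => fderiv ℝ u x v :=
    (hu.continuous_fderiv (by simp)).clm_apply continuous_const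
  have hg' : Continuous fun x => fderiv ℝ g x v :=
    (hg.continuous_fderiv (by simp)).clm_apply continuous_const
  have hc' : HasCompactSupport fun x => fderiv ℝ u x v := hc.fderiv_apply (𝕜 := ℝ) v
  apply integral_mul_fderiv_eq_neg_fderiv_mul_of_integrable
  · exact (hu'.mul hg.continuous).integrable_of_hasCompactSupport hc'.mul_right
  · exact (hu.continuous.mul hg').integrable_of_hasCompactSupport hc.mul_right
  · exact (hu.continuous.mul hg.continuous).integrable_of_hasCompactSupport hc.mul_right
  · exact fun x _ => hu.differentiable (by simp) x
  · exact fun x _ => hg.differentiable (by simp) x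

/-- The function `θ` transported from the unit ball to the ball of centre `c` and radius `r`. -/
def rescale (θ : Euc d → ℝ) (c : Euc d) (r : ℝ) (x : Euc d) : ℝ := θ (r⁻¹ • (x - c))

theorem contDiff_rescale {θ : Euc d → ℝ} (hθ : ContDiff ℝ ∞ θ) (c : Euc d) (r : ℝ) :
    ContDiff ℝ ∞ (rescale θ c r) :=
  hθ.comp ((contDiff_id.sub contDiff_const).const_smul _)

theorem fderiv_rescale {θ : Euc d → ℝ} (hθ : ContDiff ℝ ∞ θ) (c : Euc d) (r : ℝ) (x v : Euc d) :
    fderiv ℝ (rescale θ c r) x v = r⁻¹ * rescale (fun y => fderiv ℝ θ y v) c r x := by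
  have h1 : HasFDerivAt (fun x : Euc d => r⁻¹ • (x - c)) (r⁻¹ • ContinuousLinearMap.id ℝ (Euc d)) x :=
    ((hasFDerivAt_id x).sub_const c).const_smul r⁻¹
  have h2 := (hθ.differentiable (by simp) (r⁻¹ • (x - c))).hasFDerivAt.comp x h1
  have h3 : rescale θ c r = θ ∘ fun x => r⁻¹ • (x - c) := rfl
  rw [h3, h2.fderiv]
  simp [rescale]

theorem rescale_eq_zero {θ : Euc d → ℝ} (hs : tsupport θ ⊆ closedBall 0 1) {c : Euc d} {r : ℝ}
    (hr : 0 < r) {x : Euc d} (hx : x ∉ closedBall c r) : rescale θ c r x = 0 := by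
  apply image_eq_zero_of_notMem_tsupport (f := θ)
  intro h
  have h1 := hs h
  rw [mem_closedBall_zero_iff, norm_smul, norm_inv, Real.norm_eq_abs, abs_of_pos hr,
    inv_mul_le_iff₀ hr, mul_one] at h1
  exact hx (by rwa [mem_closedBall, dist_eq_norm])

theorem hasCompactSupport_rescale {θ : Euc d → ℝ} (hs : tsupport θ ⊆ closedBall 0 1) (c : Euc d)
    {r : ℝ} (hr : 0 < r) : HasCompactSupport (rescale θ c r) :=
  HasCompactSupport.intro (isCompact_closedBall c r) fun _ hx => rescale_eq_zero hs hr hx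

theorem integral_rescale (θ : Euc d → ℝ) (c : Euc d) {r : ℝ} (hr : 0 < r) :
    ∫ x, rescale θ c r x = r ^ d * ∫ x, θ x := by
  unfold rescale
  rw [integral_sub_right_eq_self (fun x => θ (r⁻¹ • x)) c, Measure.integral_comp_inv_smul]
  simp [abs_of_pos hr]

/-- Each integration by parts moves one derivative onto the cutoff and costs a factor `r⁻¹`. The new
profile `θ'` is fixed before the ball and `g`, so its bounds are uniform in them. -/
theorem exists_integral_rescale_mul_iteratedFDeriv {k : ℕ} (v : Fin k → Euc d) {θ : Euc d → ℝ}
    (hθ : ContDiff ℝ ∞ θ) (hs : tsupport θ ⊆ closedBall 0 1) :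
    ∃ θ' : Euc d → ℝ, ContDiff ℝ ∞ θ' ∧ tsupport θ' ⊆ closedBall 0 1 ∧
      ∀ (c : Euc d) (r : ℝ) (g : Euc d → ℝ), 0 < r → ContDiff ℝ ∞ g →
        ∫ x, rescale θ c r x * iteratedFDeriv ℝ k g x v =
          r⁻¹ ^ k * ∫ x, rescale θ' c r x * g x := by
  induction k generalizing θ with
  | zero =>
    refine ⟨θ, hθ, hs, fun c r g _ _ => ?_⟩
    simp
  | succ k ih =>
    have h1 : ContDiff ℝ ∞ fun y => -fderiv ℝ θ y (v 0) :=
      ((hθ.fderiv_right (m := ∞) (by simp)).clm_apply contDiff_const).neg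
    have h2 : tsupport (fun y => -fderiv ℝ θ y (v 0)) ⊆ closedBall 0 1 := by
      refine subset_trans ?_ hs
      have : tsupport (fun y => -fderiv ℝ θ y (v 0)) = tsupport fun y => fderiv ℝ θ y (v 0) := by
        simp only [tsupport, Function.support_fun_neg]
      rw [this]
      exact tsupport_fderiv_apply_subset ℝ (v 0)
    obtain ⟨θ', hθ', hs', h⟩ := ih (Fin.tail v) h1 h2
    refine ⟨θ', hθ', hs', fun c r g hr hg => ?_⟩
    have h3 : ∀ x, iteratedFDeriv ℝ (k + 1) g x v =
        fderiv ℝ (fun y => iteratedFDeriv ℝ k g y (Fin.tail v)) x (v 0) :=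
      hg.iteratedFDeriv_succ_apply k v
    simp only [h3]
    rw [integral_mul_fderiv_eq_neg ((contDiff_rescale hθ c r).of_le (by simp))
      ((hg.contDiff_iteratedFDeriv_apply k _).of_le (by simp)) (hasCompactSupport_rescale hs c hr),
      ← integral_neg, pow_succ', mul_assoc, ← h c r g hr hg, ← integral_const_mul]
    refine integral_congr_ae (Filter.Eventually.of_forall fun x => ?_)
    simp only [fderiv_rescale hθ, rescale]
    ring

end IntegrationByParts

/-! ### A priori bounds: the radius of the ball and the derivatives of the minor -/

/-- The derivative of the minor has constant sign on the ball, so its pairing with a bump is at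
least `b I r^d`. Moving its `k` derivatives to the bump, and one more because the minor is a
divergence, bounds the pairing by a constant times `r^(d - k - 1)`. Hence `r^(k + 1)` is bounded. -/
theorem exists_radius_le {n d : ℕ} (hn : 1 ≤ n) (k : ℕ) {b : ℝ} (M : ℝ) (hb : 0 < b)
    (hM : 1 ≤ M) :
    ∃ R₀ : ℝ, ∀ (c : Euc d) (r : ℝ) (Φ : Euc d → Euc n) (e : Fin n → Fin d) (β : Fin k → Fin d),
      0 < r → ContDiff ℝ ∞ Φ →
      (∀ τ ∈ closedBall c r, b ≤ |iteratedFDeriv ℝ k (minor Φ e) τ fun j => coordVec (β j)|) →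
      (∀ τ ∈ closedBall c r, ‖Φ τ‖ ≤ M) → (∀ τ ∈ closedBall c r, ‖fderiv ℝ Φ τ‖ ≤ M) →
      r ≤ R₀ := by
  let θ : ContDiffBump (0 : Euc d) := ⟨1 / 2, 1, by norm_num, by norm_num⟩
  have hθ : ContDiff ℝ ∞ (θ : Euc d → ℝ) := θ.contDiff
  have hs : tsupport (θ : Euc d → ℝ) ⊆ closedBall 0 1 := θ.tsupport_eq.subset
  have hI : 0 < ∫ x, θ x := θ.integral_pos
  set I := ∫ x, θ x with hIdef
  choose θ' hθ' hs' hint using fun β : Fin k → Fin d =>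
    exists_integral_rescale_mul_iteratedFDeriv (fun j => coordVec (β j)) hθ hs
  -- There are finitely many choices of `β` and of the last direction, so one bound `B` serves them
  -- all.
  have hB : ∀ q : (Fin k → Fin d) × Fin d, ∃ B : ℝ, ∀ x, |fderiv ℝ (θ' q.1) x (coordVec q.2)| ≤ B := by
    intro q
    have h1 : Continuous fun x => fderiv ℝ (θ' q.1) x (coordVec q.2) :=
      ((hθ' q.1).continuous_fderiv (by simp)).clm_apply continuous_const
    have h2 : HasCompactSupport (θ' q.1) :=
      HasCompactSupport.of_support_subset_isCompact (isCompact_closedBall 0 1)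
        ((subset_tsupport _).trans (hs' q.1))
    exact h1.bounded_above_of_compact_support (h2.fderiv_apply (𝕜 := ℝ) _)
  choose B₀ hB₀ using hB
  obtain ⟨B, hB⟩ := Finite.exists_le B₀
  set V : ℝ := (volume (closedBall (0 : Euc d) 1)).toReal with hV
  set Q : ℝ := B * (‖detForm n‖ * (M ^ n * M)) * V / (b * I) with hQ
  -- The argument bounds `r ^ (k + 1)`, which dominates `r` only when `r ≥ 1`.
  refine ⟨max 1 Q, fun c r Φ e β hr hΦ hbd hΦ0 hΦ1 => ?_⟩
  rcases le_total r 1 with hr1 | hr1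
  · exact hr1.trans (le_max_left _ _)
  refine le_trans ?_ (le_max_right _ _)
  have hθr : ∀ x, 0 ≤ rescale θ c r x := fun x => θ.nonneg
  have hJ := contDiff_minor hΦ e
  set D : Euc d → ℝ := fun x => iteratedFDeriv ℝ k (minor Φ e) x fun j => coordVec (β j) with hD
  have hDc : Continuous D := (hJ.contDiff_iteratedFDeriv_apply k _).continuous
  have hcs := hasCompactSupport_rescale hs c hr
  have hθc := (contDiff_rescale hθ c r).continuous
  have hi1 : Integrable fun x => rescale θ c r x * D x :=
    (hθc.mul hDc).integrable_of_hasCompactSupport hcs.mul_right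
  have hi2 : Integrable fun x => b * rescale θ c r x :=
    (hθc.integrable_of_hasCompactSupport hcs).const_mul b
  have hlow : b * (r ^ d * I) ≤ |∫ x, rescale θ c r x * D x| := by
    rw [hIdef, ← integral_rescale _ c hr, ← integral_const_mul]
    rcases forall_le_or_forall_le_neg_of_le_abs (convex_closedBall c r).isPreconnected
      hDc.continuousOn hb hbd with h | h
    · refine le_trans ?_ (le_abs_self _)
      refine integral_mono hi2 hi1 fun x => ?_
      by_cases hx : x ∈ closedBall c r
      · have := mul_le_mul_of_nonneg_left (h x hx) (hθr x)
        simp only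
        linarith
      · simp [rescale_eq_zero hs hr hx]
    · refine le_trans ?_ (neg_le_abs _)
      rw [← integral_neg]
      refine integral_mono hi2 hi1.neg fun x => ?_
      by_cases hx : x ∈ closedBall c r
      · have := mul_le_mul_of_nonneg_left (h x hx) (hθr x)
        simp only
        linarith
      · simp [rescale_eq_zero hs hr hx]
  have hθ'c : Continuous (rescale (θ' β) c r) := (contDiff_rescale (hθ' β) c r).continuous
  have hcs' := hasCompactSupport_rescale (hs' β) c hr
  have hR : ∀ i, ContDiff ℝ ∞ (replacedMinor Φ e i Φ) := fun i => contDiff_replacedMinor hΦ e i hΦ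
  have hdiv : n * ∫ x, rescale (θ' β) c r x * minor Φ e x =
      -(r⁻¹ * ∑ i, ∫ x, rescale (fun y => fderiv ℝ (θ' β) y (coordVec (e i))) c r x *
        replacedMinor Φ e i Φ x) := by
    rw [← integral_const_mul]
    calc ∫ x, n * (rescale (θ' β) c r x * minor Φ e x)
        = ∫ x, ∑ i, rescale (θ' β) c r x *
            fderiv ℝ (replacedMinor Φ e i Φ) x (coordVec (e i)) := by
          refine integral_congr_ae (Filter.Eventually.of_forall fun x => ?_)
          simp only
          rw [← Finset.mul_sum, sum_fderiv_replacedMinor hΦ e x]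
          ring
      _ = ∑ i, ∫ x, rescale (θ' β) c r x *
            fderiv ℝ (replacedMinor Φ e i Φ) x (coordVec (e i)) := by
          refine integral_finsetSum _ fun i _ => ?_
          refine Continuous.integrable_of_hasCompactSupport (hθ'c.mul ?_) hcs'.mul_right
          exact ((hR i).continuous_fderiv (by simp)).clm_apply continuous_const
      _ = _ := by
          rw [Finset.mul_sum, ← Finset.sum_neg_distrib]
          refine Finset.sum_congr rfl fun i _ => ?_
          rw [integral_mul_fderiv_eq_neg ((contDiff_rescale (hθ' β) c r).of_le (by simp))
            ((hR i).of_le (by simp)) hcs', ← integral_const_mul]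
          simp only [fderiv_rescale (hθ' β), mul_assoc]
  have hterm : ∀ i, |∫ x, rescale (fun y => fderiv ℝ (θ' β) y (coordVec (e i))) c r x *
      replacedMinor Φ e i Φ x| ≤ B * (‖detForm n‖ * (M ^ n * M)) * (r ^ d * V) := by
    intro i
    have h0 : ∀ x ∉ closedBall c r, rescale (fun y => fderiv ℝ (θ' β) y (coordVec (e i))) c r x *
      replacedMinor Φ e i Φ x = 0 := fun x hx => by
      rw [rescale_eq_zero ((tsupport_fderiv_apply_subset ℝ _).trans (hs' β)) hr hx, zero_mul]
    rw [← setIntegral_eq_integral_of_forall_compl_eq_zero h0, ← Real.norm_eq_abs]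
    refine (norm_setIntegral_le_of_norm_le_const (C := B * (‖detForm n‖ * (M ^ n * M)))
      measure_closedBall_lt_top fun x hx => ?_).trans (le_of_eq ?_)
    · rw [norm_mul]
      have h1 : ‖rescale (fun y => fderiv ℝ (θ' β) y (coordVec (e i))) c r x‖ ≤ B :=
        (hB₀ (β, e i) _).trans (hB _)
      have h2 := abs_replacedMinor_le e i Φ hM (hΦ1 x hx)
      have h3 : ‖replacedMinor Φ e i Φ x‖ ≤ ‖detForm n‖ * (M ^ n * M) := by
        refine h2.trans ?_
        gcongr
        exact hΦ0 x hx
      have hB0 : 0 ≤ B := (norm_nonneg _).trans h1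
      gcongr
    · rw [Measure.real, Measure.addHaar_closedBall _ _ hr.le]
      simp [hV, ENNReal.toReal_ofReal (pow_nonneg hr.le _), Measure.addHaar_closedBall]
  set S := ∑ i, ∫ x, rescale (fun y => fderiv ℝ (θ' β) y (coordVec (e i))) c r x *
        replacedMinor Φ e i Φ x with hS
  have hSle : |S| ≤ n * (B * (‖detForm n‖ * (M ^ n * M)) * (r ^ d * V)) := by
    refine (Finset.abs_sum_le_sum_abs _ _).trans ((Finset.sum_le_sum fun i _ => hterm i).trans ?_)
    simp
  have hn0 : (0 : ℝ) < n := by exact_mod_cast hn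
  have hmain : b * (r ^ d * I) ≤ r⁻¹ ^ k * (r⁻¹ * (B * (‖detForm n‖ * (M ^ n * M)) * (r ^ d * V))) := by
    refine hlow.trans ?_
    rw [hint β c r _ hr hJ, abs_mul, abs_of_pos (by positivity)]
    gcongr
    have h1 : |n * ∫ x, rescale (θ' β) c r x * minor Φ e x| = r⁻¹ * |S| := by
      rw [hdiv, abs_neg, abs_mul, abs_of_pos (by positivity)]
    rw [abs_mul, Nat.abs_cast] at h1
    have h2 : r⁻¹ * |S| ≤ r⁻¹ * (n * (B * (‖detForm n‖ * (M ^ n * M)) * (r ^ d * V))) := by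
      gcongr
    rw [← h1] at h2
    refine le_of_mul_le_mul_left (h2.trans (le_of_eq ?_)) hn0
    ring
  have hfin : r ^ (k + 1) ≤ Q := by
    rw [hQ, le_div_iff₀ (by positivity)]
    have h3 : r⁻¹ ^ k * (r⁻¹ * (B * (‖detForm n‖ * (M ^ n * M)) * (r ^ d * V))) =
        (r ^ d / r ^ (k + 1)) * (B * (‖detForm n‖ * (M ^ n * M)) * V) := by
      rw [pow_succ, inv_pow]; field_simp
    rw [h3] at hmain
    have h4 := mul_le_mul_of_nonneg_left hmain (a := r ^ (k + 1) / r ^ d) (by positivity)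
    calc r ^ (k + 1) * (b * I) = r ^ (k + 1) / r ^ d * (b * (r ^ d * I)) := by field_simp
      _ ≤ _ := h4
      _ = _ := by field_simp
  exact (le_self_pow₀ hr1 (by simp)).trans hfin

/-- Leibniz's rule applied to the permutation expansion of the determinant. The entries are already
first derivatives, so order `k + 1` for the minor uses order `k + 2` for `Φ`. -/
theorem exists_norm_iteratedFDeriv_minor_le (n d k : ℕ) (M : ℝ) :
    ∃ M' : ℝ, ∀ (Φ : Euc d → Euc n) (e : Fin n → Fin d) (x : Euc d), ContDiff ℝ ∞ Φ →
      (∀ j ≤ k + 2, ‖iteratedFDeriv ℝ j Φ x‖ ≤ M) →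
      ‖iteratedFDeriv ℝ (k + 1) (minor Φ e) x‖ ≤ M' := by
  classical
  set P : ℝ := ∑ p ∈ (Finset.univ : Finset (Fin n)).sym (k + 1),
    ((p : Multiset (Fin n)).countPerms : ℝ) * ∏ _j : Fin n, M with hP
  refine ⟨∑ _σ : Equiv.Perm (Fin n), P, fun Φ e x hΦ hM => ?_⟩
  have hentry : ∀ i j, ContDiff ℝ ∞ fun x => jacobianColumn Φ e i x j := fun i j =>
    (EuclideanSpace.proj (𝕜 := ℝ) j).contDiff.comp (contDiff_jacobianColumn hΦ e i)
  have hbd : ∀ i j m, m ≤ k + 1 →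
      ‖iteratedFDeriv ℝ m (fun x => jacobianColumn Φ e i x j) x‖ ≤ M := by
    intro i j m hm
    set L : (Euc d →L[ℝ] Euc n) →L[ℝ] ℝ := (EuclideanSpace.proj (𝕜 := ℝ) j) ∘L
      (ContinuousLinearMap.apply ℝ (Euc n) (coordVec (e i))) with hL
    have hL1 : ‖L‖ ≤ 1 := by
      refine ContinuousLinearMap.opNorm_le_bound _ zero_le_one fun T => ?_
      rw [one_mul]
      refine (PiLp.norm_apply_le (T (coordVec (e i))) j).trans ?_
      refine (T.le_opNorm _).trans ?_
      simp
    have h1 := L.norm_iteratedFDeriv_comp_left (f := fderiv ℝ Φ) (x := x) (n := m)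
      (hΦ.fderiv_right (m := ∞) (by simp)).contDiffAt (by exact_mod_cast le_top)
    refine h1.trans ?_
    rw [norm_iteratedFDeriv_fderiv]
    calc ‖L‖ * ‖iteratedFDeriv ℝ (m + 1) Φ x‖ ≤ 1 * M := by
          gcongr
          exact hM _ (by omega)
      _ = M := one_mul M
  have hdet : minor Φ e = fun x => ∑ σ : Equiv.Perm (Fin n), ((Equiv.Perm.sign σ : ℤ) : ℝ) •
      ∏ i, jacobianColumn Φ e i x (σ i) := by
    ext x
    rw [minor, detForm_eq_det, Matrix.det_apply']
    rfl
  have hprod : ∀ σ : Equiv.Perm (Fin n),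
      ContDiff ℝ ∞ fun x => ∏ i, jacobianColumn Φ e i x (σ i) :=
    fun σ => contDiff_prod fun i _ => hentry i (σ i)
  have hk : ((k + 1 : ℕ) : ℕ∞ω) ≤ (∞ : ℕ∞ω) := by exact_mod_cast le_top
  rw [hdet, iteratedFDeriv_fun_sum_apply fun σ _ =>
    ((hprod σ).const_smul _).contDiffAt.of_le hk]
  refine (norm_sum_le _ _).trans (Finset.sum_le_sum fun σ _ => ?_)
  rw [iteratedFDeriv_const_smul_apply' ((hprod σ).contDiffAt.of_le hk), norm_smul]
  have hsign : ‖((Equiv.Perm.sign σ : ℤ) : ℝ)‖ = 1 := by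
    rcases Int.units_eq_one_or (Equiv.Perm.sign σ) with h | h <;> simp [h]
  rw [hsign, one_mul]
  refine (norm_iteratedFDeriv_prod_le (fun i _ => hentry i (σ i)) hk).trans ?_
  refine Finset.sum_le_sum fun p _ => ?_
  gcongr with i
  refine hbd _ _ _ ((Multiset.count_le_card _ _).trans ?_)
  simp

/-! ### The translation estimate against smooth test functions -/

section Core

variable {n d : ℕ}

/-- The derivative of `u / (u² + s)` in `u` is `(s - u²) / (u² + s)²`, and `|s - u²| ≤ u² + s`.
Differentiating the weight therefore costs only `1 / (J² + s)`. -/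
theorem abs_fderiv_div_sq_add_le {J : Euc d → ℝ} {x v : Euc d} (hJ : DifferentiableAt ℝ J x)
    {s : ℝ} (hs : 0 < s) :
    |fderiv ℝ (fun x => J x / (J x ^ 2 + s)) x v| ≤ |fderiv ℝ J x v| * (J x ^ 2 + s)⁻¹ := by
  have hne : J x ^ 2 + s ≠ 0 := by positivity
  have h0 := (hasDerivAt_id (J x)).div (((hasDerivAt_id (J x)).pow 2).add_const s) hne
  have h1 : HasFDerivAt (fun x => J x / (J x ^ 2 + s)) _ x :=
    h0.comp_hasFDerivAt x hJ.hasFDerivAt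
  rw [h1.fderiv]
  have h2 : |s - J x ^ 2| ≤ J x ^ 2 + s := by
    rw [abs_le]; constructor <;> nlinarith [sq_nonneg (J x)]
  have h3 : |fderiv ℝ J x v| * (J x ^ 2 + s)⁻¹ =
      |fderiv ℝ J x v| * (J x ^ 2 + s) / (J x ^ 2 + s) ^ 2 := by
    field_simp
  rw [h3]
  have h4 : ∀ T : ℝ, T = fderiv ℝ J x v * (s - J x ^ 2) / (J x ^ 2 + s) ^ 2 →
      |T| ≤ |fderiv ℝ J x v| * (J x ^ 2 + s) / (J x ^ 2 + s) ^ 2 := by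
    rintro T rfl
    rw [abs_div, abs_mul, abs_of_pos (a := (J x ^ 2 + s) ^ 2) (by positivity)]
    gcongr
  apply h4
  simp
  ring

variable {Φ : Euc d → Euc n} {ψ : Euc d → ℝ} {e : Fin n → Fin d} {c : Euc d} {r M L s : ℝ}

/-- Cramer's rule makes the integrand a combination of derivatives of `f ∘ Φ`, and integration by
parts moves them to the coefficients. Only `|f| ≤ 1` then enters the bound, no derivative of `f`. -/
theorem abs_integral_fderiv_comp_le (hΦ : ContDiff ℝ ∞ Φ) (hψ : ContDiff ℝ 1 ψ)
    (hsupp : tsupport ψ ⊆ closedBall c r) (hM : 1 ≤ M)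
    (hΦ1 : ∀ τ ∈ closedBall c r, ‖fderiv ℝ Φ τ‖ ≤ M)
    (hΦ2 : ∀ τ ∈ closedBall c r, ‖fderiv ℝ (fderiv ℝ Φ) τ‖ ≤ M)
    (hψ0 : ∀ τ ∈ closedBall c r, |ψ τ| ≤ L)
    (hψ1 : ∀ τ ∈ closedBall c r, ‖fderiv ℝ ψ τ‖ ≤ L) (hs : 0 < s)
    {f : Euc n → ℝ} (hf : ContDiff ℝ ∞ f) (hf1 : ∀ y, |f y| ≤ 1) (z : Euc n) :
    |∫ τ, fderiv ℝ f (Φ τ) z * (minor Φ e τ ^ 2 / (minor Φ e τ ^ 2 + s) * ψ τ)| ≤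
      n * ((‖detForm n‖ * M ^ n) ^ 2 * (n + n * M + 1) * L) *
        (‖z‖ * ∫ τ in closedBall c r, (minor Φ e τ ^ 2 + s)⁻¹) := by
  set J := minor Φ e with hJdef
  have hJ : ContDiff ℝ ∞ J := contDiff_minor hΦ e
  have hpos : ∀ τ, 0 < J τ ^ 2 + s := fun τ => by positivity
  have hψc : HasCompactSupport ψ :=
    HasCompactSupport.of_support_subset_isCompact (isCompact_closedBall c r)
      ((subset_tsupport _).trans hsupp)
  set R : Fin n → Euc d → ℝ := fun i => replacedMinor Φ e i fun _ => z with hR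
  have hRs : ∀ i, ContDiff ℝ ∞ (R i) := fun i => contDiff_replacedMinor hΦ e i contDiff_const
  set g : Euc d → ℝ := fun τ => J τ / (J τ ^ 2 + s) with hg
  have hgs : ContDiff ℝ ∞ g :=
    hJ.div ((hJ.pow 2).add contDiff_const) fun τ => (hpos τ).ne'
  set q : Fin n → Euc d → ℝ := fun i τ => R i τ * g τ * ψ τ with hq
  have hqs : ∀ i, ContDiff ℝ 1 (q i) := fun i =>
    (((hRs i).mul hgs).of_le (by simp)).mul hψ
  have hqc : ∀ i, HasCompactSupport (q i) := fun i => hψc.mul_left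
  have hfΦ : ContDiff ℝ ∞ fun τ => f (Φ τ) := hf.comp hΦ
  have hchain : ∀ τ v, fderiv ℝ (fun τ => f (Φ τ)) τ v = fderiv ℝ f (Φ τ) (fderiv ℝ Φ τ v) := by
    intro τ v
    have := fderiv_comp τ (hf.differentiable (by simp) (Φ τ)) (hΦ.differentiable (by simp) τ)
    have h2 : (fun τ => f (Φ τ)) = f ∘ Φ := rfl
    rw [h2, this]
    rfl
  -- Of the two factors `J`, one is spent on Cramer's rule and the other stays in `g = J / (J² +
  -- s)`.
  have hpt : ∀ τ, fderiv ℝ f (Φ τ) z * (J τ ^ 2 / (J τ ^ 2 + s) * ψ τ) =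
      ∑ i, q i τ * fderiv ℝ (fun τ => f (Φ τ)) τ (coordVec (e i)) := by
    intro τ
    have h1 : fderiv ℝ f (Φ τ) z * J τ =
        ∑ i, R i τ * fderiv ℝ (fun τ => f (Φ τ)) τ (coordVec (e i)) := by
      have h2 := congrArg (fderiv ℝ f (Φ τ)) (minor_smul_eq_sum (Φ := Φ) e z τ)
      rw [map_smul, map_sum] at h2
      simp only [map_smul, smul_eq_mul] at h2
      rw [mul_comm, h2]
      refine Finset.sum_congr rfl fun i _ => ?_
      rw [hchain]
      rfl
    have h3 : fderiv ℝ f (Φ τ) z * (J τ ^ 2 / (J τ ^ 2 + s) * ψ τ) =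
        fderiv ℝ f (Φ τ) z * J τ * (g τ * ψ τ) := by
      simp only [hg]; ring
    rw [h3, h1, Finset.sum_mul]
    refine Finset.sum_congr rfl fun i _ => ?_
    simp only [hq]
    ring
  have hint : ∫ τ, fderiv ℝ f (Φ τ) z * (J τ ^ 2 / (J τ ^ 2 + s) * ψ τ) =
      ∑ i, -∫ τ, fderiv ℝ (q i) τ (coordVec (e i)) * f (Φ τ) := by
    simp only [hpt]
    rw [integral_finsetSum]
    · refine Finset.sum_congr rfl fun i _ => ?_
      exact integral_mul_fderiv_eq_neg (hqs i) (hfΦ.of_le (by simp)) (hqc i) _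
    · intro i _
      refine Continuous.integrable_of_hasCompactSupport ((hqs i).continuous.mul ?_)
        (hqc i).mul_right
      exact (hfΦ.continuous_fderiv (by simp)).clm_apply continuous_const
  set a : ℝ := ‖detForm n‖ * M ^ n with ha
  have ha0 : 0 ≤ a := by positivity
  have hwc : Continuous fun τ => (J τ ^ 2 + s)⁻¹ :=
    ((hJ.continuous.pow 2).add continuous_const).inv₀ fun τ => (hpos τ).ne'
  -- In `n + n * M + 1` the summands come from differentiating `R i`, `g` and `ψ` respectively.
  have hbound : ∀ i, ∀ τ ∈ closedBall c r, |fderiv ℝ (q i) τ (coordVec (e i))| ≤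
      a ^ 2 * (n + n * M + 1) * L * ‖z‖ * (J τ ^ 2 + s)⁻¹ := by
    intro i τ hτ
    have hL0 : 0 ≤ L := (abs_nonneg _).trans (hψ0 τ hτ)
    set w := (J τ ^ 2 + s)⁻¹ with hw
    have hw0 : 0 < w := inv_pos.2 (hpos τ)
    have e1 : |R i τ| ≤ a * ‖z‖ := by
      have := abs_replacedMinor_le (Φ := Φ) e i (fun _ => z) hM (hΦ1 τ hτ)
      rw [ha, mul_assoc]; exact this
    have e2 : |fderiv ℝ (R i) τ (coordVec (e i))| ≤ n * (a * ‖z‖) := by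
      have := abs_fderiv_replacedMinor_le hΦ e i i z hM (hΦ1 τ hτ) (hΦ2 τ hτ)
      rw [ha, mul_assoc]; exact this
    have e3 : |g τ| ≤ a * w := by
      have := abs_minor_le (Φ := Φ) e (hΦ1 τ hτ)
      simp only [hg]
      rw [abs_div, abs_of_pos (hpos τ), div_eq_mul_inv]
      gcongr
    have e4 : |fderiv ℝ g τ (coordVec (e i))| ≤ n * (a * M) * w := by
      refine (abs_fderiv_div_sq_add_le (hJ.differentiable (by simp) τ) hs).trans ?_
      gcongr
      have := abs_fderiv_minor_le hΦ e i hM (hΦ1 τ hτ) (hΦ2 τ hτ)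
      rw [ha, mul_assoc]; exact this
    have e5 : |fderiv ℝ ψ τ (coordVec (e i))| ≤ L := by
      refine ((fderiv ℝ ψ τ).le_opNorm _).trans ?_
      simpa using hψ1 τ hτ
    have e6 := hψ0 τ hτ
    have hRd := (hRs i).differentiable (by simp) τ
    have hgd := hgs.differentiable (by simp) τ
    have hψd := hψ.differentiable (by simp) τ
    have hder : fderiv ℝ (q i) τ (coordVec (e i)) =
        R i τ * g τ * fderiv ℝ ψ τ (coordVec (e i)) +
          ψ τ * (R i τ * fderiv ℝ g τ (coordVec (e i)) +
            g τ * fderiv ℝ (R i) τ (coordVec (e i))) := by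
      have hRg : DifferentiableAt ℝ (fun τ => R i τ * g τ) τ := hRd.mul hgd
      rw [show q i = fun τ => (R i τ * g τ) * ψ τ from rfl, fderiv_fun_mul hRg hψd,
        fderiv_fun_mul hRd hgd]
      simp
      ring
    rw [hder]
    calc _ ≤ |R i τ| * |g τ| * |fderiv ℝ ψ τ (coordVec (e i))| +
          |ψ τ| * (|R i τ| * |fderiv ℝ g τ (coordVec (e i))| +
            |g τ| * |fderiv ℝ (R i) τ (coordVec (e i))|) := by
          refine (abs_add_le _ _).trans ?_
          rw [abs_mul, abs_mul, abs_mul (ψ τ)]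
          gcongr
          refine (abs_add_le _ _).trans ?_
          rw [abs_mul, abs_mul]
      _ ≤ (a * ‖z‖) * (a * w) * L + L * ((a * ‖z‖) * (n * (a * M) * w) +
            (a * w) * (n * (a * ‖z‖))) := by gcongr
      _ = _ := by ring
  have hzero : ∀ i, ∀ τ ∉ closedBall c r, fderiv ℝ (q i) τ (coordVec (e i)) * f (Φ τ) = 0 := by
    intro i τ hτ
    have h1 : τ ∉ tsupport (fun x => fderiv ℝ (q i) x (coordVec (e i))) := fun h =>
      hτ (hsupp (closure_mono (Function.support_mul_subset_right _ _)
        (tsupport_fderiv_apply_subset ℝ _ h)))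
    have h2 := image_eq_zero_of_notMem_tsupport h1
    rw [h2, zero_mul]
  rw [hint]
  refine (Finset.abs_sum_le_sum_abs _ _).trans ?_
  calc _ ≤ ∑ _i : Fin n, a ^ 2 * (n + n * M + 1) * L * ‖z‖ *
        ∫ τ in closedBall c r, (J τ ^ 2 + s)⁻¹ := by
        refine Finset.sum_le_sum fun i _ => ?_
        rw [abs_neg, ← setIntegral_eq_integral_of_forall_compl_eq_zero (hzero i),
          ← integral_const_mul, ← Real.norm_eq_abs]
        refine norm_integral_le_of_norm_le ?_ ?_
        · exact ((continuous_const.mul hwc).continuousOn.integrableOn_compact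
            (isCompact_closedBall c r))
        · refine (ae_restrict_iff' measurableSet_closedBall).2
            (Filter.Eventually.of_forall fun τ hτ => ?_)
          rw [norm_mul, Real.norm_eq_abs, Real.norm_eq_abs]
          refine (mul_le_of_le_one_right (abs_nonneg _) (hf1 _)).trans (hbound i τ hτ)
    _ = _ := by
        simp only [Finset.sum_const, Finset.card_univ, Fintype.card_fin, nsmul_eq_mul]
        ring

/-- Mean value inequality on `[0, 1]` for `t ↦ ∫ f(Φ + t z) ρ`. Along the way `f` is replaced by its
translates, for which the previous bound is the same. -/
theorem abs_integral_translate_sub_le_of_fderiv {ρ : Euc d → ℝ} (hΦ : Continuous Φ)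
    (hρ : Continuous ρ) (hρc : HasCompactSupport ρ) {f : Euc n → ℝ} (hf : ContDiff ℝ ∞ f)
    (hfc : HasCompactSupport f) (z : Euc n) {K : ℝ}
    (h : ∀ t : ℝ, |∫ τ, fderiv ℝ f (Φ τ + t • z) z * ρ τ| ≤ K) :
    |∫ τ, (f (Φ τ + z) - f (Φ τ)) * ρ τ| ≤ K := by
  have hf' : Continuous fun y => fderiv ℝ f y z :=
    (hf.continuous_fderiv (by simp)).clm_apply continuous_const
  obtain ⟨B, hB⟩ := hf'.bounded_above_of_compact_support (hfc.fderiv_apply (𝕜 := ℝ) z)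
  have hfcont := hf.continuous
  have hint : ∀ t : ℝ, Integrable fun τ => f (Φ τ + t • z) * ρ τ := fun t =>
    Continuous.integrable_of_hasCompactSupport (by fun_prop) hρc.mul_left
  have hd : ∀ t : ℝ, HasDerivAt (fun t : ℝ => ∫ τ, f (Φ τ + t • z) * ρ τ)
      (∫ τ, fderiv ℝ f (Φ τ + t • z) z * ρ τ) t := by
    intro t
    refine (hasDerivAt_integral_of_dominated_loc_of_deriv_le
      (F := fun t τ => f (Φ τ + t • z) * ρ τ)
      (F' := fun t τ => fderiv ℝ f (Φ τ + t • z) z * ρ τ)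
      (bound := fun τ => B * |ρ τ|) (s := univ) Filter.univ_mem ?_ (hint t) ?_ ?_ ?_ ?_).2
    · exact Filter.Eventually.of_forall fun t => (hint t).aestronglyMeasurable
    · refine Continuous.aestronglyMeasurable ?_
      exact (hf'.comp (hΦ.add continuous_const)).mul hρ
    · refine Filter.Eventually.of_forall fun τ t _ => ?_
      rw [norm_mul, Real.norm_eq_abs (ρ τ)]
      gcongr
      exact hB _
    · exact (hρ.integrable_of_hasCompactSupport hρc).abs.const_mul B
    · refine Filter.Eventually.of_forall fun τ t _ => ?_
      have h1 : HasDerivAt (fun t : ℝ => Φ τ + t • z) z t := by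
        simpa using ((hasDerivAt_id t).smul_const z).const_add (Φ τ)
      exact ((hf.differentiable (by simp) _).hasFDerivAt.comp_hasDerivAt t h1).mul_const (ρ τ)
  have h1 := (convex_univ (𝕜 := ℝ) (E := ℝ)).norm_image_sub_le_of_norm_hasDerivWithin_le
    (f := fun t : ℝ => ∫ τ, f (Φ τ + t • z) * ρ τ) (C := K)
    (fun t _ => (hd t).hasDerivWithinAt) (fun t _ => h t) (mem_univ 0) (mem_univ 1)
  simp only [one_smul, zero_smul, add_zero, sub_zero, norm_one, mul_one] at h1
  rw [← integral_sub (by simpa using hint 1) (by simpa using hint 0)] at h1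
  rw [← Real.norm_eq_abs]
  simpa only [sub_mul] using h1

end Core

/-- The density is split with the weights `J²/(J² + s)` and `s/(J² + s)`: the first part is
integrated by parts, the second is estimated trivially, and both reduce to `∫ s/(J² + s)`. -/
theorem exists_integral_translate_sub_le {n : ℕ} (hn : 1 ≤ n) (d k : ℕ) {δ b : ℝ} (M L : ℝ)
    (hδ : 0 < δ) (hδ1 : δ ≤ 1) (hk : 2 * (k : ℝ) * δ < 1) (hb : 0 < b) :
    ∃ C : ℝ, 0 ≤ C ∧ ∀ (c : Euc d) (r : ℝ) (Φ : Euc d → Euc n) (ψ : Euc d → ℝ)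
      (e : Fin n → Fin d) (β : Fin k → Fin d),
      0 < r → ContDiff ℝ ∞ Φ → ContDiff ℝ 1 ψ → tsupport ψ ⊆ closedBall c r →
      (∀ τ ∈ closedBall c r, b ≤ |iteratedFDeriv ℝ k (minor Φ e) τ fun j => coordVec (β j)|) →
      (∀ τ ∈ closedBall c r, ∀ j ≤ k + 2, ‖iteratedFDeriv ℝ j Φ τ‖ ≤ M) →
      (∀ τ ∈ closedBall c r, |ψ τ| ≤ L) → (∀ τ ∈ closedBall c r, ‖fderiv ℝ ψ τ‖ ≤ L) →
      (∫ τ, |ψ τ| ≤ C) ∧ ∀ (z : Euc n) (f : Euc n → ℝ), ContDiff ℝ ∞ f → HasCompactSupport f →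
        (∀ y, |f y| ≤ 1) → |∫ τ, (f (Φ τ + z) - f (Φ τ)) * ψ τ| ≤ C * ‖z‖ ^ δ := by
  set M₁ := max M 1 with hM₁
  set L₁ := max L 0 with hL₁
  have hL0 : 0 ≤ L₁ := le_max_right _ _
  have hM1 : 1 ≤ M₁ := le_max_right _ _
  obtain ⟨R₀, hR₀⟩ := exists_radius_le (d := d) hn k M₁ hb hM1
  obtain ⟨M', hM'⟩ := exists_norm_iteratedFDeriv_minor_le n d k M
  obtain ⟨C₄, hC₄⟩ := exists_lintegral_div_sq_add_le d k M' R₀ hδ hδ1 hk hb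
  set V : ℝ := (volume (closedBall (0 : Euc d) R₀)).toReal with hV
  set A : ℝ := n * ((‖detForm n‖ * M₁ ^ n) ^ 2 * (n + n * M₁ + 1) * L₁) with hA
  have hA0 : 0 ≤ A := by positivity
  have hV0 : 0 ≤ V := ENNReal.toReal_nonneg
  refine ⟨L₁ * V + (A + 2 * L₁) * C₄, by positivity,
    fun c r Φ ψ e β hr hΦ hψ hsupp hbd hΦb hψ0 hψ1 => ?_⟩
  have hψ0' : ∀ τ ∈ closedBall c r, |ψ τ| ≤ L₁ := fun τ hτ => (hψ0 τ hτ).trans (le_max_left _ _)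
  have hψ1' : ∀ τ ∈ closedBall c r, ‖fderiv ℝ ψ τ‖ ≤ L₁ := fun τ hτ =>
    (hψ1 τ hτ).trans (le_max_left _ _)
  have hΦ0 : ∀ τ ∈ closedBall c r, ‖Φ τ‖ ≤ M₁ := fun τ hτ => by
    have := hΦb τ hτ 0 (by omega)
    rw [norm_iteratedFDeriv_zero] at this
    exact this.trans (le_max_left _ _)
  have hΦ1 : ∀ τ ∈ closedBall c r, ‖fderiv ℝ Φ τ‖ ≤ M₁ := fun τ hτ => by
    have := hΦb τ hτ 1 (by omega)
    rw [← norm_iteratedFDeriv_fderiv, norm_iteratedFDeriv_zero] at this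
    exact this.trans (le_max_left _ _)
  have hΦ2 : ∀ τ ∈ closedBall c r, ‖fderiv ℝ (fderiv ℝ Φ) τ‖ ≤ M₁ := fun τ hτ => by
    have := hΦb τ hτ 2 (by omega)
    rw [← norm_iteratedFDeriv_fderiv, ← norm_iteratedFDeriv_fderiv,
      norm_iteratedFDeriv_zero] at this
    exact this.trans (le_max_left _ _)
  have hrR : r ≤ R₀ := hR₀ c r Φ e β hr hΦ hbd hΦ0 hΦ1
  have hJ := contDiff_minor hΦ e
  have hψc : HasCompactSupport ψ :=
    HasCompactSupport.of_support_subset_isCompact (isCompact_closedBall c r)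
      ((subset_tsupport _).trans hsupp)
  have hψz : ∀ τ ∉ closedBall c r, ψ τ = 0 := fun τ hτ =>
    image_eq_zero_of_notMem_tsupport fun h => hτ (hsupp h)
  constructor
  · rw [← setIntegral_eq_integral_of_forall_compl_eq_zero (s := closedBall c r)
      fun τ hτ => by simp [hψz τ hτ]]
    have h1 := norm_setIntegral_le_of_norm_le_const (μ := volume) (f := fun τ => |ψ τ|) (C := L₁)
      (measure_closedBall_lt_top (x := c) (r := r)) fun τ hτ => by simpa using hψ0' τ hτ
    refine (le_abs_self _).trans (h1.trans ?_)
    have h2 : volume.real (closedBall c r) ≤ V := by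
      rw [Measure.real, Measure.addHaar_closedBall_center, hV]
      exact ENNReal.toReal_mono measure_closedBall_lt_top.ne
        (measure_mono (closedBall_subset_closedBall hrR))
    have h3 : 0 ≤ (A + 2 * L₁) * C₄ := by positivity
    have h4 : L₁ * volume.real (closedBall c r) ≤ L₁ * V := by gcongr
    linarith
  intro z f hf hfc hf1
  have hCle : (A + 2 * L₁) * C₄ * ‖z‖ ^ δ ≤ (L₁ * V + (A + 2 * L₁) * C₄) * ‖z‖ ^ δ := by
    gcongr
    have : 0 ≤ L₁ * V := by positivity
    linarith
  refine le_trans ?_ hCle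
  rcases eq_or_ne z 0 with rfl | hz
  · simp only [add_zero, sub_self, zero_mul, integral_zero, abs_zero]
    positivity
  -- The two parts are bounded by `‖z‖ ∫ 1/(J² + s)` and `s ∫ 1/(J² + s)` up to constants; this
  -- choice of `s` makes them equal.
  set s : ℝ := ‖z‖ with hs
  have hs0 : 0 < s := norm_pos_iff.2 hz
  set J := minor Φ e with hJdef
  have hpos : ∀ τ, 0 < J τ ^ 2 + s := fun τ => by positivity
  have hwc : Continuous fun τ => (J τ ^ 2 + s)⁻¹ :=
    ((hJ.continuous.pow 2).add continuous_const).inv₀ fun τ => (hpos τ).ne'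
  have hwi : IntegrableOn (fun τ => (J τ ^ 2 + s)⁻¹) (closedBall c r) :=
    hwc.continuousOn.integrableOn_compact (isCompact_closedBall c r)
  set W : ℝ := s * ∫ τ in closedBall c r, (J τ ^ 2 + s)⁻¹ with hW
  have hWle : W ≤ C₄ * s ^ δ := by
    have h1 := hC₄ c r J (fun j => coordVec (β j)) hrR hJ (fun j => by simp) hbd
      (fun τ hτ => hM' Φ e τ hΦ (hΦb τ hτ)) s hs0
    rw [hW, ← integral_const_mul]
    have h2 : ∀ τ, s * (J τ ^ 2 + s)⁻¹ = s / (J τ ^ 2 + s) := fun τ => (div_eq_mul_inv _ _).symm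
    simp only [h2]
    rw [integral_eq_lintegral_of_nonneg_ae
      (Filter.Eventually.of_forall fun τ => (div_pos hs0 (hpos τ)).le)
      (by simp only [← h2]; exact (continuous_const.mul hwc).aestronglyMeasurable)]
    refine ENNReal.toReal_le_of_le_ofReal (by positivity) (h1.trans (le_of_eq ?_))
    rw [ENNReal.ofReal_mul (by simp), ENNReal.ofReal_coe_nnreal]
  set ρ : Euc d → ℝ := fun τ => J τ ^ 2 / (J τ ^ 2 + s) * ψ τ with hρ
  set κ : Euc d → ℝ := fun τ => s * (J τ ^ 2 + s)⁻¹ * ψ τ with hκ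
  have hρcont : Continuous ρ := by
    have h1 : ρ = fun τ => J τ ^ 2 * (J τ ^ 2 + s)⁻¹ * ψ τ := by
      ext τ; simp [hρ, div_eq_mul_inv]
    rw [h1]
    exact ((hJ.continuous.pow 2).mul hwc).mul hψ.continuous
  have hκcont : Continuous κ := (continuous_const.mul hwc).mul hψ.continuous
  have hρc : HasCompactSupport ρ := hψc.mul_left
  have hκc : HasCompactSupport κ := hψc.mul_left
  have hsplit : ∀ τ, (f (Φ τ + z) - f (Φ τ)) * ψ τ =
      (f (Φ τ + z) - f (Φ τ)) * ρ τ + (f (Φ τ + z) - f (Φ τ)) * κ τ := by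
    intro τ
    have : ψ τ = ρ τ + κ τ := by
      simp only [hρ, hκ]
      have := (hpos τ).ne'
      field_simp
    rw [← mul_add, ← this]
  have hfd : Continuous fun τ => f (Φ τ + z) - f (Φ τ) := by
    have h1 := hf.continuous
    have h2 := hΦ.continuous
    fun_prop
  simp only [hsplit]
  have hiρ : Integrable fun τ => (f (Φ τ + z) - f (Φ τ)) * ρ τ :=
    (hfd.mul hρcont).integrable_of_hasCompactSupport hρc.mul_left
  have hiκ : Integrable fun τ => (f (Φ τ + z) - f (Φ τ)) * κ τ :=
    (hfd.mul hκcont).integrable_of_hasCompactSupport hκc.mul_left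
  rw [integral_add hiρ hiκ]
  have hfirst : |∫ τ, (f (Φ τ + z) - f (Φ τ)) * ρ τ| ≤ A * W := by
    refine abs_integral_translate_sub_le_of_fderiv hΦ.continuous hρcont hρc hf hfc z fun t => ?_
    have h1 : ContDiff ℝ ∞ fun y => f (y + t • z) := hf.comp (contDiff_id.add contDiff_const)
    have h2 := abs_integral_fderiv_comp_le (e := e) hΦ hψ hsupp hM1 hΦ1 hΦ2 hψ0' hψ1' hs0 h1
      (fun y => hf1 _) z
    simpa only [fderiv_comp_add_right] using h2
  have hsecond : |∫ τ, (f (Φ τ + z) - f (Φ τ)) * κ τ| ≤ 2 * L₁ * W := by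
    rw [← setIntegral_eq_integral_of_forall_compl_eq_zero (s := closedBall c r)
      fun τ hτ => by simp [hκ, hψz τ hτ], hW, ← mul_assoc, ← integral_const_mul,
      ← Real.norm_eq_abs]
    refine norm_integral_le_of_norm_le (hwi.const_mul _) ?_
    refine (ae_restrict_iff' measurableSet_closedBall).2
      (Filter.Eventually.of_forall fun τ hτ => ?_)
    have h1 : |f (Φ τ + z) - f (Φ τ)| ≤ 2 :=
      (abs_sub _ _).trans (by linarith [hf1 (Φ τ + z), hf1 (Φ τ)])
    have h2 := hψ0' τ hτ
    have h3 := inv_pos.2 (hpos τ)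
    simp only [hκ]
    rw [Real.norm_eq_abs, abs_mul, abs_mul, abs_mul, abs_of_pos hs0, abs_of_pos h3]
    calc _ ≤ 2 * (s * (J τ ^ 2 + s)⁻¹ * L₁) := by gcongr
      _ = _ := by ring
  calc _ ≤ A * W + 2 * L₁ * W := (abs_add_le _ _).trans (add_le_add hfirst hsecond)
    _ = (A + 2 * L₁) * W := by ring
    _ ≤ (A + 2 * L₁) * (C₄ * s ^ δ) := by gcongr
    _ = _ := by ring

/-! ### From smooth test functions to Borel sets and total variation -/

/-- Indicators are approximated in `L^1` by smooth functions with values in `[0, 1]`. -/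
theorem exists_contDiff_lintegral_sub_indicator_le {n : ℕ} (ν : Measure (Euc n))
    [IsFiniteMeasure ν] {P : Set (Euc n)} (hP : MeasurableSet P) {ε : ℝ≥0∞} (hε : ε ≠ 0) :
    ∃ g : Euc n → ℝ, ContDiff ℝ ∞ g ∧ HasCompactSupport g ∧ (∀ y, g y ∈ Icc (0 : ℝ) 1) ∧
      ∫⁻ y, ‖g y - P.indicator 1 y‖ₑ ∂ν ≤ ε := by
  have hε2 : ε / 2 ≠ 0 := (ENNReal.half_pos hε).ne'
  obtain ⟨K, hKP, hK, hKε⟩ := hP.exists_isCompact_sdiff_lt (measure_ne_top ν P) hε2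
  -- `U₀` surrounds the compact `K`, not necessarily `P`. A function equal to `1` on `K` and `0` off
  -- `U` can differ from the indicator only on `U \ K` and `P \ K`; cutting `U` down to a ball makes
  -- its support compact.
  obtain ⟨U₀, hKU, hU₀, hUε⟩ := K.exists_isOpen_lt_add (μ := ν) (measure_ne_top ν K) hε2
  obtain ⟨ρ, hρ⟩ := hK.isBounded.subset_ball 0
  set U := U₀ ∩ ball 0 ρ with hUdef
  have hU : IsOpen U := hU₀.inter isOpen_ball
  have hKU' : K ⊆ U := subset_inter hKU hρ
  obtain ⟨f, hf0, hf1, hf01⟩ := exists_contMDiffMap_zero_one_of_isClosed (n := ⊤)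
    (modelWithCornersSelf ℝ (Euc n)) hU.isClosed_compl hK.isClosed
    (disjoint_left.2 fun x hx hx' => hx (hKU' hx'))
  refine ⟨f, f.contMDiff.contDiff, ?_, hf01, ?_⟩
  · refine HasCompactSupport.intro (isCompact_closedBall (0 : Euc n) ρ) fun x hx => hf0 ?_
    exact fun h => hx (ball_subset_closedBall h.2)
  have hUK : ν (U \ K) ≤ ε / 2 := by
    have h1 : ν (U₀ \ K) < ε / 2 := by
      rw [measure_sdiff hKU hK.measurableSet.nullMeasurableSet (measure_ne_top ν K)]
      exact ENNReal.sub_lt_of_lt_add (measure_mono hKU) (by rwa [add_comm] at hUε)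
    exact (measure_mono (sdiff_subset_sdiff_left inter_subset_left)).trans h1.le
  calc ∫⁻ y, ‖f y - P.indicator 1 y‖ₑ ∂ν
      ≤ ∫⁻ y, ((U \ K).indicator 1 y + (P \ K).indicator 1 y) ∂ν := by
        refine lintegral_mono fun y => ?_
        have hle : ‖f y - P.indicator 1 y‖ₑ ≤ 1 := by
          rw [← ofReal_norm, ← ENNReal.ofReal_one]
          apply ENNReal.ofReal_le_ofReal
          have h1 := hf01 y
          have h2 : P.indicator (1 : Euc n → ℝ) y ∈ Icc (0 : ℝ) 1 := by
            by_cases h : y ∈ P <;> simp [h]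
          rw [Real.norm_eq_abs, abs_le]
          constructor <;> linarith [h1.1, h1.2, h2.1, h2.2]
        by_cases hyK : y ∈ K
        · have h1 : f y = 1 := hf1 hyK
          simp [h1, hKP hyK]
        · by_cases hyU : y ∈ U
          · refine hle.trans ?_
            simp [hyU, hyK]
          · by_cases hyP : y ∈ P
            · refine hle.trans ?_
              simp [hyP, hyK]
            · have h1 : f y = 0 := hf0 hyU
              simp [h1, hyP]
    _ = ν (U \ K) + ν (P \ K) := by
        rw [lintegral_add_left (measurable_one.indicator (hU.measurableSet.diff hK.measurableSet)),
          lintegral_indicator_one (hU.measurableSet.diff hK.measurableSet),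
          lintegral_indicator_one (hP.diff hK.measurableSet)]
    _ ≤ ε / 2 + ε / 2 := by gcongr
    _ = ε := ENNReal.add_halves ε

theorem integral_indicator_comp_mul {n d : ℕ} {ψ : Euc d → ℝ} {F : Euc d → Euc n}
    (hF : Measurable F) {P : Set (Euc n)} (hP : MeasurableSet P) :
    ∫ τ, P.indicator 1 (F τ) * ψ τ = ∫ τ in F ⁻¹' P, ψ τ := by
  rw [← integral_indicator (hF hP)]
  refine integral_congr_ae (Filter.Eventually.of_forall fun τ => ?_)
  by_cases h : F τ ∈ P
  · simp [h]
  · simp [h]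

/-- A bound for the difference of two transported measures, tested against smooth functions,
passes to their values on Borel sets. -/
theorem setIntegral_preimage_sub_le_of_smooth {n d : ℕ} {ψ : Euc d → ℝ} (hψ : Integrable ψ)
    {F₁ F₂ : Euc d → Euc n} (hF₁ : Measurable F₁) (hF₂ : Measurable F₂) {K : ℝ}
    (h : ∀ f : Euc n → ℝ, ContDiff ℝ ∞ f → HasCompactSupport f → (∀ y, |f y| ≤ 1) →
      |∫ τ, (f (F₁ τ) - f (F₂ τ)) * ψ τ| ≤ K) {P : Set (Euc n)} (hP : MeasurableSet P) :
    ((∫ τ in F₁ ⁻¹' P, ψ τ) - ∫ τ in F₁ ⁻¹' Pᶜ, ψ τ) -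
      ((∫ τ in F₂ ⁻¹' P, ψ τ) - ∫ τ in F₂ ⁻¹' Pᶜ, ψ τ) ≤ K := by
  set lam : Measure (Euc d) := volume.withDensity fun τ => ‖ψ τ‖ₑ with hlam
  have : IsFiniteMeasure lam := isFiniteMeasure_withDensity hψ.2.ne
  -- The sum of both image measures, so that a single approximant serves `F₁` and `F₂`.
  set ν : Measure (Euc n) := lam.map F₁ + lam.map F₂ with hν
  have happrox : ∀ ε : ℝ, 0 < ε → ∀ Q : Set (Euc n), MeasurableSet Q → ∃ g : Euc n → ℝ,
      ContDiff ℝ ∞ g ∧ HasCompactSupport g ∧ (∀ y, g y ∈ Icc (0 : ℝ) 1) ∧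
      ∀ F : Euc d → Euc n, Measurable F → lam.map F ≤ ν →
        Integrable (fun τ => g (F τ) * ψ τ) ∧
        |(∫ τ, g (F τ) * ψ τ) - ∫ τ in F ⁻¹' Q, ψ τ| ≤ ε := by
    intro ε hε Q hQ
    obtain ⟨g, hg, hgc, hg01, hgε⟩ := exists_contDiff_lintegral_sub_indicator_le ν hQ
      (ENNReal.ofReal_pos.2 hε).ne'
    refine ⟨g, hg, hgc, hg01, fun F hF hFν => ?_⟩
    have hgm : Measurable g := hg.continuous.measurable
    have hi1 : Integrable fun τ => g (F τ) * ψ τ :=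
      hψ.bdd_mul (c := 1) (hgm.comp hF).aestronglyMeasurable
        (Filter.Eventually.of_forall fun τ => by
          rw [Real.norm_eq_abs, abs_of_nonneg (hg01 _).1]; exact (hg01 _).2)
    have hQm : Measurable (Q.indicator (1 : Euc n → ℝ)) := measurable_one.indicator hQ
    have hi2 : Integrable fun τ => Q.indicator 1 (F τ) * ψ τ :=
      hψ.bdd_mul (c := 1) (hQm.comp hF).aestronglyMeasurable
        (Filter.Eventually.of_forall fun τ => by
          by_cases h : F τ ∈ Q <;> simp [h])
    refine ⟨hi1, ?_⟩
    rw [← integral_indicator_comp_mul hF hQ, ← integral_sub hi1 hi2, ← Real.norm_eq_abs]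
    refine (norm_integral_le_lintegral_norm _).trans (ENNReal.toReal_le_of_le_ofReal hε.le ?_)
    calc ∫⁻ τ, ENNReal.ofReal ‖g (F τ) * ψ τ - Q.indicator 1 (F τ) * ψ τ‖
        = ∫⁻ τ, ‖ψ τ‖ₑ * ‖g (F τ) - Q.indicator 1 (F τ)‖ₑ := by
          refine lintegral_congr fun τ => ?_
          rw [← sub_mul, ofReal_norm, enorm_mul, mul_comm]
      _ = ∫⁻ τ, ‖g (F τ) - Q.indicator 1 (F τ)‖ₑ ∂lam := by
          rw [hlam, lintegral_withDensity_eq_lintegral_mul_non_measurable₀]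
          · rfl
          · exact hψ.1.enorm
          · exact Filter.Eventually.of_forall fun τ => by simp
      _ = ∫⁻ y, ‖g y - Q.indicator 1 y‖ₑ ∂(lam.map F) := by
          rw [lintegral_map (f := fun y => ‖g y - Q.indicator 1 y‖ₑ) (hgm.sub hQm).enorm hF]
      _ ≤ ∫⁻ y, ‖g y - Q.indicator 1 y‖ₑ ∂ν := lintegral_mono' hFν le_rfl
      _ ≤ _ := hgε
  refine le_of_forall_pos_le_add fun ε hε => ?_
  -- `g₁ - g₂` approximates `1` on `P` and `-1` on its complement, and is admissible since both
  -- functions take values in `[0, 1]`. It produces four errors of size `ε / 4`.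
  obtain ⟨g₁, hg₁, hgc₁, hg₁01, happ₁⟩ := happrox (ε / 4) (by positivity) P hP
  obtain ⟨g₂, hg₂, hgc₂, hg₂01, happ₂⟩ := happrox (ε / 4) (by positivity) Pᶜ hP.compl
  have hle₁ : lam.map F₁ ≤ ν := Measure.le_add_right le_rfl
  have hle₂ : lam.map F₂ ≤ ν := Measure.le_add_left le_rfl
  obtain ⟨i11, b11⟩ := happ₁ F₁ hF₁ hle₁
  obtain ⟨i12, b12⟩ := happ₁ F₂ hF₂ hle₂
  obtain ⟨i21, b21⟩ := happ₂ F₁ hF₁ hle₁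
  obtain ⟨i22, b22⟩ := happ₂ F₂ hF₂ hle₂
  have hfin := h (fun y => g₁ y - g₂ y) (hg₁.sub hg₂) (hgc₁.sub hgc₂) fun y => by
    have h1 := hg₁01 y
    have h2 := hg₂01 y
    rw [abs_le]
    constructor <;> linarith [h1.1, h1.2, h2.1, h2.2]
  have heq : ∫ τ, ((g₁ (F₁ τ) - g₂ (F₁ τ)) - (g₁ (F₂ τ) - g₂ (F₂ τ))) * ψ τ =
      ((∫ τ, g₁ (F₁ τ) * ψ τ) - ∫ τ, g₂ (F₁ τ) * ψ τ) -
        ((∫ τ, g₁ (F₂ τ) * ψ τ) - ∫ τ, g₂ (F₂ τ) * ψ τ) := by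
    have hs1 : Integrable fun τ => g₁ (F₁ τ) * ψ τ - g₂ (F₁ τ) * ψ τ := i11.sub i21
    have hs2 : Integrable fun τ => g₁ (F₂ τ) * ψ τ - g₂ (F₂ τ) * ψ τ := i12.sub i22
    rw [← integral_sub i11 i21, ← integral_sub i12 i22, ← integral_sub hs1 hs2]
    congr 1
    ext τ
    ring
  rw [heq] at hfin
  have k0 := (abs_le.1 hfin).2
  have k1 := abs_le.1 b11
  have k2 := abs_le.1 b12
  have k3 := abs_le.1 b21
  have k4 := abs_le.1 b22
  linarith [k1.1, k1.2, k2.1, k2.2, k3.1, k3.2, k4.1, k4.2]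

/-- The total variation of an integrable function is controlled by its values on Borel sets. -/
theorem lintegral_enorm_le_of_forall_setIntegral {α : Type*} [MeasurableSpace α] {μ : Measure α}
    {g : α → ℝ} (hg : Integrable g μ) {K : ℝ}
    (h : ∀ P, MeasurableSet P → (∫ y in P, g y ∂μ) - ∫ y in Pᶜ, g y ∂μ ≤ K) :
    ∫⁻ y, ‖g y‖ₑ ∂μ ≤ ENNReal.ofReal K := by
  set g' := hg.1.mk g with hg'
  have hm : StronglyMeasurable g' := hg.1.stronglyMeasurable_mk
  have hae : g =ᵐ[μ] g' := hg.1.ae_eq_mk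
  have hi : Integrable g' μ := hg.congr hae
  -- The Hahn decomposition: with this `P` the hypothesis bounds the integral of `|g|`.
  set P : Set α := {y | 0 ≤ g' y} with hPdef
  have hP : MeasurableSet P := measurableSet_le measurable_const hm.measurable
  have h1 := h P hP
  rw [setIntegral_congr_ae₀ hP.nullMeasurableSet (g := fun y => |g' y|),
    setIntegral_congr_ae₀ hP.compl.nullMeasurableSet (g := fun y => -|g' y|), integral_neg,
    sub_neg_eq_add, integral_add_compl hP hi.abs] at h1
  · have h3 : ∫⁻ y, ‖g y‖ₑ ∂μ = ∫⁻ y, ‖g' y‖ₑ ∂μ :=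
      lintegral_congr_ae (hae.fun_comp (fun x => ‖x‖ₑ))
    rw [h3]
    have h2 := ofReal_integral_norm_eq_lintegral_enorm hi
    calc ∫⁻ y, ‖g' y‖ₑ ∂μ = ENNReal.ofReal (∫ y, ‖g' y‖ ∂μ) := h2.symm
      _ ≤ _ := ENNReal.ofReal_le_ofReal h1
  · filter_upwards [hae] with y hy hyP
    have : g' y < 0 := not_le.1 hyP
    rw [hy, abs_of_neg this, neg_neg]
  · filter_upwards [hae] with y hy hyP
    rw [hy, abs_of_nonneg hyP]

/-! ### Absolute continuity and bounds for the density -/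

section Density

variable {n d : ℕ} {Φ : Euc d → Euc n} {ψ : Euc d → ℝ} {C δ : ℝ}

/-- By Tonelli, for almost every `z` the measure translated by `z` gives mass zero to `A`. Such `z`
are dense, and translation by `z` changes the mass of `A` by at most `C ‖z‖ ^ δ`, so `z → 0`
concludes. -/
theorem setIntegral_preimage_eq_zero_of_null (hψ : Integrable ψ) (hΦ : Measurable Φ) (hδ : 0 < δ)
    (h : ∀ (z : Euc n) (f : Euc n → ℝ), ContDiff ℝ ∞ f → HasCompactSupport f →
        (∀ y, |f y| ≤ 1) → |∫ τ, (f (Φ τ + z) - f (Φ τ)) * ψ τ| ≤ C * ‖z‖ ^ δ)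
    (hC : 0 ≤ C) {A : Set (Euc n)} (hA : MeasurableSet A) (hA0 : volume A = 0) :
    ∫ τ in Φ ⁻¹' A, ψ τ = 0 := by
  set m : Euc n → Set (Euc n) → ℝ := fun z P => ∫ τ in (fun τ => Φ τ + z) ⁻¹' P, ψ τ with hm
  have hmz : ∀ z, Measurable fun τ => Φ τ + z := fun z => hΦ.add_const z
  have hm0 : ∀ P, m 0 P = ∫ τ in Φ ⁻¹' P, ψ τ := fun P => by simp [hm]
  have hsum : ∀ z P, MeasurableSet P → m z P + m z Pᶜ = ∫ τ, ψ τ := fun z P hP => by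
    simp only [hm]
    rw [preimage_compl]
    exact integral_add_compl ((hmz z) hP) hψ
  -- Total mass is invariant under translation, so the estimate on `P` minus its complement is twice
  -- this difference; the factor `2` is dropped.
  have hdiff : ∀ z P, MeasurableSet P → m z P - m 0 P ≤ C * ‖z‖ ^ δ := by
    intro z P hP
    have h1 := setIntegral_preimage_sub_le_of_smooth hψ (hmz z) hΦ (h z) hP
    rw [← hm0, ← hm0] at h1
    change m z P - m z Pᶜ - (m 0 P - m 0 Pᶜ) ≤ _ at h1
    have h2 := hsum z P hP
    have h3 := hsum 0 P hP
    have h4 : 0 ≤ C * ‖z‖ ^ δ := by positivity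
    linarith
  have hae : ∀ᵐ z : Euc n, m z A = 0 := by
    have hmeas : Measurable fun p : Euc n × Euc d => A.indicator (1 : Euc n → ℝ≥0∞) (Φ p.2 + p.1) := by
      have : Measurable (A.indicator (1 : Euc n → ℝ≥0∞)) := measurable_one.indicator hA
      fun_prop
    have h1 : ∫⁻ z : Euc n, ∫⁻ τ : Euc d, A.indicator (1 : Euc n → ℝ≥0∞) (Φ τ + z) = 0 := by
      rw [lintegral_lintegral_swap hmeas.aemeasurable]
      have h2 : ∀ τ, ∫⁻ z : Euc n, A.indicator (1 : Euc n → ℝ≥0∞) (Φ τ + z) = 0 := fun τ => by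
        rw [lintegral_add_left_eq_self (A.indicator (1 : Euc n → ℝ≥0∞)), lintegral_indicator_one hA,
          hA0]
      simp [h2]
    rw [lintegral_eq_zero_iff (hmeas.lintegral_prod_right')] at h1
    filter_upwards [h1] with z hz
    have hz' : ∫⁻ τ : Euc d, ((fun τ => Φ τ + z) ⁻¹' A).indicator 1 τ = 0 := hz
    rw [lintegral_indicator_one ((hmz z) hA)] at hz'
    exact setIntegral_measure_zero _ hz'
  have habs : ∀ z P, MeasurableSet P → |m z P - m 0 P| ≤ C * ‖z‖ ^ δ := by
    intro z P hP
    rw [abs_le]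
    have h1 := hdiff z P hP
    have h2 := hdiff z Pᶜ hP.compl
    have h3 := hsum z P hP
    have h4 := hsum 0 P hP
    constructor <;> linarith
  rw [← hm0]
  have hlim : Filter.Tendsto (fun ρ : ℝ => C * ρ ^ δ) (nhdsWithin 0 (Ioi 0)) (nhds 0) := by
    have h1 : ContinuousAt (fun ρ : ℝ => C * ρ ^ δ) 0 :=
      continuousAt_const.mul (Real.continuousAt_rpow_const _ _ (Or.inr hδ.le))
    have h2 := h1.tendsto
    simp only [Real.zero_rpow hδ.ne', mul_zero] at h2
    exact h2.mono_left nhdsWithin_le_nhds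
  have hbd : ∀ ρ : ℝ, 0 < ρ → |m 0 A| ≤ C * ρ ^ δ := by
    intro ρ hρ
    obtain ⟨z, hz0, hz⟩ := (Measure.dense_of_ae hae).exists_mem_open (isOpen_ball (x := 0) (ε := ρ))
      ⟨0, mem_ball_self hρ⟩
    have h6 := habs z A hA
    have h7 : m z A = 0 := hz0
    rw [h7, zero_sub, abs_neg] at h6
    refine h6.trans ?_
    have h8 : ‖z‖ ≤ ρ := (mem_ball_zero_iff.1 hz).le
    gcongr
  have h5 : |m 0 A| ≤ 0 :=
    ge_of_tendsto hlim (Filter.eventually_of_mem self_mem_nhdsWithin fun ρ hρ => hbd ρ hρ)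
  exact abs_nonpos_iff.1 h5

theorem lintegral_enorm_density_le (hψ : Integrable ψ) (hΦ : Measurable Φ)
    {h : Euc n → ℝ} (hh : Integrable h)
    (hm : ∀ P, MeasurableSet P → ∫ y in P, h y = ∫ τ in Φ ⁻¹' P, ψ τ) :
    ∫⁻ y, ‖h y‖ₑ ≤ ENNReal.ofReal (∫ τ, |ψ τ|) := by
  refine lintegral_enorm_le_of_forall_setIntegral hh fun P hP => ?_
  rw [hm P hP, hm Pᶜ hP.compl, preimage_compl, ← integral_add_compl (hΦ hP) hψ.abs]
  have h1 : ∀ s : Set (Euc d), |∫ τ in s, ψ τ| ≤ ∫ τ in s, |ψ τ| := fun s =>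
    abs_integral_le_integral_abs
  have h2 := (abs_le.1 (h1 (Φ ⁻¹' P))).2
  have h3 := (abs_le.1 (h1 (Φ ⁻¹' P)ᶜ)).1
  linarith

/-- The function `h (y - z)` is the density of the image under `Φ + z`, so the comparison of two
image measures on Borel sets applies. -/
theorem lintegral_enorm_density_translate_sub_le (hψ : Integrable ψ) (hΦ : Measurable Φ)
    {h : Euc n → ℝ} (hh : Integrable h)
    (hm : ∀ P, MeasurableSet P → ∫ y in P, h y = ∫ τ in Φ ⁻¹' P, ψ τ) (z : Euc n) {K : ℝ}
    (hK : ∀ f : Euc n → ℝ, ContDiff ℝ ∞ f → HasCompactSupport f →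
        (∀ y, |f y| ≤ 1) → |∫ τ, (f (Φ τ + z) - f (Φ τ)) * ψ τ| ≤ K) :
    ∫⁻ y, ‖h (y - z) - h y‖ₑ ≤ ENNReal.ofReal K := by
  have hz : Integrable fun y => h (y - z) := hh.comp_sub_right z
  refine lintegral_enorm_le_of_forall_setIntegral (hz.sub hh) fun P hP => ?_
  have h1 : ∀ Q, MeasurableSet Q → ∫ y in Q, (h (y - z) - h y) =
      (∫ τ in (fun τ => Φ τ + z) ⁻¹' Q, ψ τ) - ∫ τ in Φ ⁻¹' Q, ψ τ := by
    intro Q hQ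
    rw [integral_sub hz.integrableOn hh.integrableOn, hm Q hQ]
    congr 1
    have h2 : MeasurableSet ((fun y => y + z) ⁻¹' Q) := (measurable_add_const z) hQ
    have h3 := hm _ h2
    rw [← preimage_comp] at h3
    change _ = ∫ τ in (fun τ => Φ τ + z) ⁻¹' Q, ψ τ at h3
    rw [← h3, ← integral_indicator hQ, ← integral_indicator h2,
      ← integral_sub_right_eq_self (((fun y => y + z) ⁻¹' Q).indicator h) z]
    refine integral_congr_ae (Filter.Eventually.of_forall fun y => ?_)
    by_cases hy : y ∈ Q <;> simp [hy, indicator]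
  have h4 := setIntegral_preimage_sub_le_of_smooth hψ (hΦ.add_const z) hΦ hK hP
  simp only [Pi.sub_apply]
  rw [h1 P hP, h1 Pᶜ hP.compl]
  linarith

end Density

/-! ### Reduction to a map that is smooth on the whole space -/

section Localization

variable {𝕜 : Type*} [RCLike 𝕜] {n d : ℕ} {c : Euc d} {R : ℝ} {Φ : Euc d → Euc n} {ψ : Euc d → 𝕜}

/-- The map of a transport setting coincides, near the support of the density, with a smooth map
defined on the whole space. -/
theorem IsTransportSetting.exists_contDiff_eventuallyEq (h : IsTransportSetting c R Φ ψ) :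
    ∃ (r : ℝ) (Ψ : Euc d → Euc n), 0 < r ∧ r < R ∧ tsupport ψ ⊆ closedBall c r ∧
      ContDiff ℝ ∞ Ψ ∧ ∀ τ ∈ closedBall c r, Ψ =ᶠ[nhds τ] Φ := by
  obtain ⟨r, ⟨hr0, hrR⟩, hr⟩ := exists_pos_lt_subset_ball h.radius_pos (isClosed_tsupport ψ)
    h.support_subset
  -- Both radii lie strictly between `r` and `R`: the cutoff is `1` on a neighbourhood of the
  -- smaller closed ball, and its support stays inside the open ball where `Φ` is smooth.
  let χ : ContDiffBump c := ⟨(2 * r + R) / 3, (r + 2 * R) / 3, by linarith, by linarith⟩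
  refine ⟨r, fun τ => χ τ • Φ τ, hr0, hrR, hr.trans ball_subset_closedBall, ?_, ?_⟩
  · rw [contDiff_iff_contDiffAt]
    intro τ
    by_cases hτ : τ ∈ ball c R
    · refine χ.contDiff.contDiffAt.smul (h.smooth_map.contDiffAt ?_)
      exact Filter.mem_of_superset (isOpen_ball.mem_nhds hτ) ball_subset_closedBall
    · have h1 : τ ∉ tsupport χ := by
        rw [χ.tsupport_eq]
        intro h2
        refine hτ (closedBall_subset_ball ?_ h2)
        change (r + 2 * R) / 3 < R
        linarith
      have h2 : (fun τ => χ τ • Φ τ) =ᶠ[nhds τ] fun _ => 0 := by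
        filter_upwards [notMem_tsupport_iff_eventuallyEq.1 h1] with x hx
        simp [hx]
      exact contDiffAt_const.congr_of_eventuallyEq h2
  · intro τ hτ
    have h1 : τ ∈ ball c ((2 * r + R) / 3) := closedBall_subset_ball (by linarith) hτ
    filter_upwards [isOpen_ball.mem_nhds h1] with x hx
    rw [χ.one_of_mem_closedBall (ball_subset_closedBall hx), one_smul]

theorem closedBall_eventuallyEq_univ {r : ℝ} (hrR : r < R) {τ : Euc d} (hτ : τ ∈ closedBall c r) :
    closedBall c R =ᶠ[nhds τ] (univ : Set (Euc d)) := by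
  refine Filter.eventuallyEq_univ.2 ?_
  exact Filter.mem_of_superset (isOpen_ball.mem_nhds (closedBall_subset_ball hrR hτ))
    ball_subset_closedBall

theorem iteratedFDerivWithin_closedBall_eq {F : Type*} [NormedAddCommGroup F] [NormedSpace ℝ F]
    {f g : Euc d → F} {r : ℝ} (hrR : r < R) {τ : Euc d} (hτ : τ ∈ closedBall c r)
    (hfg : g =ᶠ[nhds τ] f) (j : ℕ) :
    iteratedFDerivWithin ℝ j f (closedBall c R) τ = iteratedFDeriv ℝ j g τ := by
  rw [iteratedFDerivWithin_congr_set (closedBall_eventuallyEq_univ hrR hτ),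
    iteratedFDerivWithin_univ]
  exact (hfg.symm.iteratedFDeriv ℝ j).eq_of_nhds

theorem jacobianMinor_eventuallyEq {Ψ : Euc d → Euc n} {r : ℝ} (hrR : r < R)
    {τ : Euc d} (hτ : τ ∈ closedBall c r) (hΨ : Ψ =ᶠ[nhds τ] Φ) (e : Fin n ↪o Fin d) :
    minor Ψ e =ᶠ[nhds τ] jacobianMinor Φ (closedBall c R) e := by
  filter_upwards [hΨ.eventuallyEq_nhds, isOpen_ball.mem_nhds (closedBall_subset_ball hrR hτ)]
    with x hx hxR
  have h1 : fderivWithin ℝ Φ (closedBall c R) x = fderiv ℝ Ψ x := by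
    rw [fderivWithin_of_mem_nhds, hx.fderiv_eq]
    exact Filter.mem_of_superset (isOpen_ball.mem_nhds hxR) ball_subset_closedBall
  rw [minor, detForm_eq_det, jacobianMinor]
  congr 1
  ext i j
  simp [jacobianMatrix, jacobianColumn, h1]

theorem length_variableList (α : Fin d → ℕ) : (variableList α).length = ∑ i, α i := by
  simp [variableList, List.length_flatMap, ← List.ofFn_eq_map, List.sum_ofFn]

theorem exists_partialDeriv_eq {k : ℕ} {α : Fin d → ℕ} (hα : ∑ i, α i = k) :
    ∃ β : Fin k → Fin d, ∀ (f : Euc d → ℝ) (s : Set (Euc d)) (x : Euc d),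
      partialDeriv α f s x = iteratedFDerivWithin ℝ k f s x fun j => coordVec (β j) := by
  rw [← length_variableList] at hα
  subst hα
  exact ⟨(variableList α).get, fun f s x => rfl⟩

theorem norm_iteratedFDerivWithin_le_of_ckNorm_le {V W : Type*} [NormedAddCommGroup V]
    [NormedSpace ℝ V] [NormedAddCommGroup W] [NormedSpace ℝ W] {m : ℕ} {f : V → W} {s : Set V}
    {M : ℝ} (h : ckNorm m f s ≤ ENNReal.ofReal M) {j : ℕ} (hj : j ≤ m) {x : V} (hx : x ∈ s) :
    ‖iteratedFDerivWithin ℝ j f s x‖ ≤ max M 0 := by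
  have h1 : ‖iteratedFDerivWithin ℝ j f s x‖ₑ ≤ ENNReal.ofReal M := by
    refine le_trans ?_ h
    refine le_trans ?_ (le_iSup₂ (f := fun j _ => ⨆ x ∈ s, ‖iteratedFDerivWithin ℝ j f s x‖ₑ) j
      (Finset.mem_range.2 (Nat.lt_succ_of_le hj)))
    exact le_iSup₂ (f := fun x _ => ‖iteratedFDerivWithin ℝ j f s x‖ₑ) x hx
  rw [← ofReal_norm] at h1
  -- `ENNReal.ofReal` sends negative numbers to `0`, and `M` may be negative.
  have h2 : ENNReal.ofReal M = ENNReal.ofReal (max M 0) := by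
    rcases le_total M 0 with h3 | h3
    · rw [max_eq_right h3, ENNReal.ofReal_of_nonpos h3, ENNReal.ofReal_zero]
    · rw [max_eq_left h3]
  rw [h2] at h1
  exact (ENNReal.ofReal_le_ofReal_iff (le_max_right _ _)).1 h1

theorem IsTransportSetting.hasCompactSupport (h : IsTransportSetting c R Φ ψ) :
    HasCompactSupport ψ :=
  HasCompactSupport.of_support_subset_isCompact (isCompact_closedBall c R)
    ((subset_tsupport _).trans (h.support_subset.trans ball_subset_closedBall))

theorem IsTransportSetting.integrable (h : IsTransportSetting c R Φ ψ) : Integrable ψ :=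
  h.contDiff_density.continuous.integrable_of_hasCompactSupport h.hasCompactSupport

/-- The density vanishes off the smaller ball, so changing the map there does not affect the
measure. -/
theorem transport_apply (h : IsTransportSetting c R Φ ψ) {r : ℝ} {Ψ : Euc d → Euc n}
    (hsupp : tsupport ψ ⊆ closedBall c r) (hΨ : Measurable Ψ)
    (heq : ∀ τ ∈ closedBall c r, Ψ τ = Φ τ) {A : Set (Euc n)} (hA : MeasurableSet A) :
    transport c R Φ ψ A = ∫ τ in Ψ ⁻¹' A, ψ τ := by
  have hm : Measurable fun τ : closedBall c R => Φ τ :=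
    (continuousOn_iff_continuous_domRestrict.1 h.smooth_map.continuousOn).measurable
  have hemb : MeasurableEmbedding (Subtype.val : closedBall c R → Euc d) :=
    MeasurableEmbedding.subtype_coe measurableSet_closedBall
  have hi : Integrable (fun τ : closedBall c R => ψ τ)
      ((volume : Measure (Euc d)).comap Subtype.val) := by
    have h1 : Integrable ψ (((volume : Measure (Euc d)).comap
        (Subtype.val : closedBall c R → Euc d)).map Subtype.val) := by
      rw [map_comap_subtype_coe measurableSet_closedBall]
      exact h.integrable.integrableOn
    exact (hemb.integrable_map_iff).1 h1
  rw [transport, VectorMeasure.map_apply _ hm hA, withDensityᵥ_apply hi (hm hA),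
    ← integral_indicator (hm hA), ← integral_indicator (hΨ hA)]
  have hpt : ∀ τ : closedBall c R,
      ((fun τ : closedBall c R => Φ τ) ⁻¹' A).indicator (fun τ => ψ τ) τ =
        (Ψ ⁻¹' A).indicator ψ (τ : Euc d) := by
    intro τ
    by_cases hτ : (τ : Euc d) ∈ closedBall c r
    · have h1 := heq _ hτ
      by_cases h2 : Φ τ ∈ A
      · rw [indicator_of_mem (by exact h2), indicator_of_mem (by rwa [mem_preimage, h1])]
      · rw [indicator_of_notMem (by exact h2), indicator_of_notMem (by rwa [mem_preimage, h1])]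
    · have h0 : ψ τ = 0 := image_eq_zero_of_notMem_tsupport fun h1 => hτ (hsupp h1)
      simp [indicator, h0]
  simp only [hpt]
  rw [integral_subtype_comap measurableSet_closedBall (fun τ => (Ψ ⁻¹' A).indicator ψ τ)]
  refine setIntegral_eq_integral_of_forall_compl_eq_zero fun τ hτ => ?_
  have h0 : ψ τ = 0 := image_eq_zero_of_notMem_tsupport fun h1 =>
    hτ (ball_subset_closedBall (h.support_subset h1))
  simp [indicator, h0]

end Localization

/-! ### Real and imaginary parts -/

section Complex

variable {𝕜 : Type*} [RCLike 𝕜] {n d : ℕ}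

theorem norm_fderiv_clm_comp_le {ψ : Euc d → 𝕜} (hψ : ContDiff ℝ 1 ψ) (T : 𝕜 →L[ℝ] ℝ)
    (hT : ‖T‖ ≤ 1) (τ : Euc d) : ‖fderiv ℝ (fun τ => T (ψ τ)) τ‖ ≤ ‖fderiv ℝ ψ τ‖ := by
  have h1 := (T.hasFDerivAt (x := ψ τ)).comp τ (hψ.differentiable (by simp) τ).hasFDerivAt
  have h2 : (fun τ => T (ψ τ)) = T ∘ ψ := rfl
  rw [h2, h1.fderiv]
  refine (ContinuousLinearMap.opNorm_comp_le _ _).trans ?_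
  exact mul_le_of_le_one_left (norm_nonneg _) hT

theorem norm_reCLM_le : ‖(RCLike.reCLM : 𝕜 →L[ℝ] ℝ)‖ ≤ 1 :=
  ContinuousLinearMap.opNorm_le_bound _ zero_le_one fun x => by
    simpa using RCLike.abs_re_le_norm x

theorem norm_imCLM_le : ‖(RCLike.imCLM : 𝕜 →L[ℝ] ℝ)‖ ≤ 1 :=
  ContinuousLinearMap.opNorm_le_bound _ zero_le_one fun x => by
    simpa using RCLike.abs_im_le_norm x

theorem tsupport_clm_comp_subset (ψ : Euc d → 𝕜) (T : 𝕜 →L[ℝ] ℝ) :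
    tsupport (fun τ => T (ψ τ)) ⊆ tsupport ψ :=
  closure_mono fun τ hτ h0 => hτ (by simp [h0])

theorem enorm_le_enorm_re_add_enorm_im (x : 𝕜) :
    ‖x‖ₑ ≤ ‖RCLike.reCLM x‖ₑ + ‖RCLike.imCLM x‖ₑ := by
  rw [← ofReal_norm, ← ofReal_norm, ← ofReal_norm,
    ← ENNReal.ofReal_add (norm_nonneg _) (norm_nonneg _)]
  apply ENNReal.ofReal_le_ofReal
  calc ‖x‖ = ‖((RCLike.re x : ℝ) : 𝕜) + ((RCLike.im x : ℝ) : 𝕜) * RCLike.I‖ := by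
        rw [RCLike.re_add_im]
    _ ≤ |RCLike.re x| + |RCLike.im x| * ‖(RCLike.I : 𝕜)‖ := by
        refine (norm_add_le _ _).trans ?_
        rw [norm_mul, RCLike.norm_ofReal, RCLike.norm_ofReal]
    _ ≤ |RCLike.re x| + |RCLike.im x| * 1 := by
        gcongr
        rw [RCLike.norm_I]; split_ifs <;> norm_num
    _ = _ := by rw [mul_one]; rfl

theorem lintegral_enorm_le_re_add_im {α : Type*} [MeasurableSpace α] {μ : Measure α} {f : α → 𝕜}
    (hf : AEStronglyMeasurable f μ) :
    ∫⁻ y, ‖f y‖ₑ ∂μ ≤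
      (∫⁻ y, ‖RCLike.reCLM (f y)‖ₑ ∂μ) + ∫⁻ y, ‖RCLike.imCLM (f y)‖ₑ ∂μ := by
  rw [← lintegral_add_left' ((RCLike.reCLM (K := 𝕜)).continuous.comp_aestronglyMeasurable hf).enorm]
  exact lintegral_mono fun y => enorm_le_enorm_re_add_enorm_im _

/-- The real-level smoothness estimate for the measure transported by `Ψ` with density `ψ`. -/
def HasSmoothBound (Ψ : Euc d → Euc n) (δ C : ℝ) (ψ : Euc d → ℝ) : Prop :=
  (∫ τ, |ψ τ| ≤ C) ∧ ∀ (z : Euc n) (f : Euc n → ℝ), ContDiff ℝ ∞ f → HasCompactSupport f →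
    (∀ y, |f y| ≤ 1) → |∫ τ, (f (Ψ τ + z) - f (Ψ τ)) * ψ τ| ≤ C * ‖z‖ ^ δ

variable {Ψ : Euc d → Euc n} {ψ : Euc d → 𝕜} {δ C : ℝ} {h : Euc n → 𝕜}

theorem setIntegral_clm_eq (hψ : Integrable ψ) (hh : Integrable h)
    (hd : ∀ P, MeasurableSet P → ∫ y in P, h y = ∫ τ in Ψ ⁻¹' P, ψ τ) (T : 𝕜 →L[ℝ] ℝ)
    (P : Set (Euc n)) (hP : MeasurableSet P) :
    ∫ y in P, T (h y) = ∫ τ in Ψ ⁻¹' P, T (ψ τ) := by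
  rw [T.integral_comp_comm hh.integrableOn, T.integral_comp_comm hψ.integrableOn, hd P hP]

theorem lintegral_enorm_clm_le (hψ : Integrable ψ) (hΨ : Measurable Ψ) (hh : Integrable h)
    (hd : ∀ P, MeasurableSet P → ∫ y in P, h y = ∫ τ in Ψ ⁻¹' P, ψ τ) (T : 𝕜 →L[ℝ] ℝ)
    (hT : HasSmoothBound Ψ δ C fun τ => T (ψ τ)) : ∫⁻ y, ‖T (h y)‖ₑ ≤ ENNReal.ofReal C :=
  (lintegral_enorm_density_le (T.integrable_comp hψ) hΨ (T.integrable_comp hh)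
    (setIntegral_clm_eq hψ hh hd T)).trans (ENNReal.ofReal_le_ofReal hT.1)

theorem lintegral_enorm_clm_translate_sub_le (hψ : Integrable ψ) (hΨ : Measurable Ψ)
    (hh : Integrable h) (hd : ∀ P, MeasurableSet P → ∫ y in P, h y = ∫ τ in Ψ ⁻¹' P, ψ τ)
    (T : 𝕜 →L[ℝ] ℝ) (hT : HasSmoothBound Ψ δ C fun τ => T (ψ τ)) (z : Euc n) :
    ∫⁻ y, ‖T (h (y - z) - h y)‖ₑ ≤ ENNReal.ofReal (C * ‖z‖ ^ δ) := by
  simp only [map_sub]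
  exact lintegral_enorm_density_translate_sub_le (T.integrable_comp hψ) hΨ
    (T.integrable_comp hh) (setIntegral_clm_eq hψ hh hd T) z (hT.2 z)

theorem eLpNorm_density_le (hψ : Integrable ψ) (hΨ : Measurable Ψ) (hh : Integrable h)
    (hd : ∀ P, MeasurableSet P → ∫ y in P, h y = ∫ τ in Ψ ⁻¹' P, ψ τ)
    (hre : HasSmoothBound Ψ δ C fun τ => RCLike.reCLM (ψ τ))
    (him : HasSmoothBound Ψ δ C fun τ => RCLike.imCLM (ψ τ)) :
    eLpNorm h 1 volume ≤ 2 * ENNReal.ofReal C := by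
  rw [eLpNorm_one_eq_lintegral_enorm, two_mul]
  exact (lintegral_enorm_le_re_add_im hh.1).trans
    (add_le_add (lintegral_enorm_clm_le hψ hΨ hh hd _ hre) (lintegral_enorm_clm_le hψ hΨ hh hd _ him))

theorem hasTranslationBound_density (hδ : 0 < δ) (hC : 0 ≤ C) (hψ : Integrable ψ)
    (hΨ : Measurable Ψ) (hh : Integrable h)
    (hd : ∀ P, MeasurableSet P → ∫ y in P, h y = ∫ τ in Ψ ⁻¹' P, ψ τ)
    (hre : HasSmoothBound Ψ δ C fun τ => RCLike.reCLM (ψ τ))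
    (him : HasSmoothBound Ψ δ C fun τ => RCLike.imCLM (ψ τ)) :
    HasTranslationBound δ h (2 * C.toNNReal) := by
  intro z
  have h1 : AEStronglyMeasurable (fun y => h (y - z) - h y) volume :=
    ((hh.comp_sub_right z).sub hh).1
  have h2 : ENNReal.ofReal (C * ‖z‖ ^ δ) = ENNReal.ofReal C * ‖z‖ₑ ^ δ := by
    rw [ENNReal.ofReal_mul hC, ← ENNReal.ofReal_rpow_of_nonneg (norm_nonneg _) hδ.le, ofReal_norm]
  have h3 : ((2 * C.toNNReal : ℝ≥0) : ℝ≥0∞) * ‖z‖ₑ ^ δ =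
      ENNReal.ofReal (C * ‖z‖ ^ δ) + ENNReal.ofReal (C * ‖z‖ ^ δ) := by
    rw [h2, ← two_mul, ENNReal.coe_mul, mul_assoc, ENNReal.coe_ofNat, ENNReal.ofReal]
  rw [h3]
  exact (lintegral_enorm_le_re_add_im h1).trans
    (add_le_add (lintegral_enorm_clm_translate_sub_le hψ hΨ hh hd _ hre z)
      (lintegral_enorm_clm_translate_sub_le hψ hΨ hh hd _ him z))

theorem l1DeltaNorm_density_le (hδ : 0 < δ) (hC : 0 ≤ C) (hψ : Integrable ψ)
    (hΨ : Measurable Ψ) (hh : Integrable h)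
    (hd : ∀ P, MeasurableSet P → ∫ y in P, h y = ∫ τ in Ψ ⁻¹' P, ψ τ)
    (hre : HasSmoothBound Ψ δ C fun τ => RCLike.reCLM (ψ τ))
    (him : HasSmoothBound Ψ δ C fun τ => RCLike.imCLM (ψ τ)) :
    l1DeltaNorm δ h ≤ ENNReal.ofReal (4 * C) := by
  have h1 := eLpNorm_density_le hψ hΨ hh hd hre him
  have h2 := hasTranslationBound_density hδ hC hψ hΨ hh hd hre him
  have h3 : (⨅ (A : ℝ≥0) (_ : HasTranslationBound δ h A), (A : ℝ≥0∞)) ≤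
      ((2 * C.toNNReal : ℝ≥0) : ℝ≥0∞) := iInf₂_le _ h2
  -- The real and imaginary parts give `2 * C` for the `L^1` norm and `2 * C` for the translation
  -- constant.
  refine (add_le_add h1 h3).trans (le_of_eq ?_)
  rw [ENNReal.ofReal_mul (by norm_num), ENNReal.coe_mul, ENNReal.coe_ofNat,
    ← ENNReal.ofReal.eq_1 C, ← add_mul]
  norm_num

/-- The Radon–Nikodym theorem for signed measures; the two parts of a complex density are obtained
separately from it. -/
theorem exists_real_density {φ : Euc d → ℝ} (hφ : Integrable φ) (hΨ : Measurable Ψ)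
    (h0 : ∀ P : Set (Euc n), MeasurableSet P → volume P = 0 → ∫ τ in Ψ ⁻¹' P, φ τ = 0) :
    ∃ g : Euc n → ℝ, Integrable g ∧
      ∀ P, MeasurableSet P → ∫ y in P, g y = ∫ τ in Ψ ⁻¹' P, φ τ := by
  set s : SignedMeasure (Euc n) := ((volume : Measure (Euc d)).withDensityᵥ φ).map Ψ with hs
  have hsP : ∀ P, MeasurableSet P → s P = ∫ τ in Ψ ⁻¹' P, φ τ := fun P hP => by
    rw [hs, VectorMeasure.map_apply _ hΨ hP, withDensityᵥ_apply hφ (hΨ hP)]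
  have hac : s ≪ᵥ (volume : Measure (Euc n)).toENNRealVectorMeasure := by
    refine VectorMeasure.AbsolutelyContinuous.mk fun P hP hv => ?_
    rw [Measure.toENNRealVectorMeasure_apply_measurable hP] at hv
    rw [hsP P hP, h0 P hP hv]
  refine ⟨s.rnDeriv volume, SignedMeasure.integrable_rnDeriv _ _, fun P hP => ?_⟩
  rw [← hsP P hP, ← withDensityᵥ_apply (SignedMeasure.integrable_rnDeriv _ _) hP,
    SignedMeasure.withDensityᵥ_rnDeriv_eq s volume hac]

theorem setIntegral_eq_re_add_im {α : Type*} [MeasurableSpace α] {μ : Measure α} {f : α → 𝕜}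
    (hf : Integrable f μ) :
    ∫ x, f x ∂μ = ((∫ x, RCLike.reCLM (f x) ∂μ : ℝ) : 𝕜) +
      ((∫ x, RCLike.imCLM (f x) ∂μ : ℝ) : 𝕜) * RCLike.I := by
  rw [RCLike.reCLM.integral_comp_comm hf, RCLike.imCLM.integral_comp_comm hf]
  simp [RCLike.re_add_im]

theorem setIntegral_preimage_eq_zero (hδ : 0 < δ) (hC : 0 ≤ C) (hψ : Integrable ψ)
    (hΨ : Measurable Ψ)
    (hre : HasSmoothBound Ψ δ C fun τ => RCLike.reCLM (ψ τ))
    (him : HasSmoothBound Ψ δ C fun τ => RCLike.imCLM (ψ τ)) {P : Set (Euc n)}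
    (hP : MeasurableSet P) (hP0 : volume P = 0) : ∫ τ in Ψ ⁻¹' P, ψ τ = 0 := by
  rw [setIntegral_eq_re_add_im hψ.integrableOn,
    setIntegral_preimage_eq_zero_of_null (RCLike.reCLM.integrable_comp hψ) hΨ hδ hre.2 hC hP hP0,
    setIntegral_preimage_eq_zero_of_null (RCLike.imCLM.integrable_comp hψ) hΨ hδ him.2 hC hP hP0]
  simp

theorem exists_density (hδ : 0 < δ) (hC : 0 ≤ C) (hψ : Integrable ψ) (hΨ : Measurable Ψ)
    (hre : HasSmoothBound Ψ δ C fun τ => RCLike.reCLM (ψ τ))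
    (him : HasSmoothBound Ψ δ C fun τ => RCLike.imCLM (ψ τ)) :
    ∃ h : Euc n → 𝕜, Integrable h ∧
      ∀ P, MeasurableSet P → ∫ y in P, h y = ∫ τ in Ψ ⁻¹' P, ψ τ := by
  have h1 := RCLike.reCLM.integrable_comp hψ
  have h2 := RCLike.imCLM.integrable_comp hψ
  obtain ⟨g₁, hg₁, hd₁⟩ := exists_real_density (Ψ := Ψ) h1 hΨ fun P hP hP0 =>
    setIntegral_preimage_eq_zero_of_null h1 hΨ hδ hre.2 hC hP hP0
  obtain ⟨g₂, hg₂, hd₂⟩ := exists_real_density (Ψ := Ψ) h2 hΨ fun P hP hP0 =>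
    setIntegral_preimage_eq_zero_of_null h2 hΨ hδ him.2 hC hP hP0
  have i1 : Integrable fun y => ((g₁ y : ℝ) : 𝕜) := hg₁.ofReal
  have i2 : Integrable fun y => ((g₂ y : ℝ) : 𝕜) * RCLike.I := hg₂.ofReal.mul_const _
  refine ⟨fun y => (g₁ y : 𝕜) + (g₂ y : 𝕜) * RCLike.I, i1.add i2, fun P hP => ?_⟩
  rw [integral_add i1.integrableOn i2.integrableOn, integral_mul_const, integral_ofReal,
    integral_ofReal, hd₁ P hP, hd₂ P hP, setIntegral_eq_re_add_im (f := ψ) hψ.integrableOn]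

end Complex

/-! ### Uniform estimates for `𝕜`-valued densities -/

section Assembly

variable {𝕜 : Type*} [RCLike 𝕜]

/-- A real-linear functional of norm at most `1` preserves the support condition and the `C^1`
bound, so the real estimate holds for both parts with the same constant. -/
theorem exists_hasSmoothBound (𝕜 : Type*) [RCLike 𝕜] {n : ℕ} (hn : 1 ≤ n) (d k : ℕ) {δ b : ℝ}
    (M L : ℝ) (hδ : 0 < δ) (hδ1 : δ ≤ 1) (hk : 2 * (k : ℝ) * δ < 1) (hb : 0 < b) :
    ∃ C : ℝ, 0 ≤ C ∧ ∀ (c : Euc d) (r : ℝ) (Ψ : Euc d → Euc n) (ψ : Euc d → 𝕜)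
      (e : Fin n → Fin d) (β : Fin k → Fin d),
      0 < r → ContDiff ℝ ∞ Ψ → ContDiff ℝ 1 ψ → tsupport ψ ⊆ closedBall c r →
      (∀ τ ∈ closedBall c r, b ≤ |iteratedFDeriv ℝ k (minor Ψ e) τ fun j => coordVec (β j)|) →
      (∀ τ ∈ closedBall c r, ∀ j ≤ k + 2, ‖iteratedFDeriv ℝ j Ψ τ‖ ≤ M) →
      (∀ τ ∈ closedBall c r, ∀ j ≤ 1, ‖iteratedFDeriv ℝ j ψ τ‖ ≤ L) →
      HasSmoothBound Ψ δ C (fun τ => RCLike.reCLM (ψ τ)) ∧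
        HasSmoothBound Ψ δ C (fun τ => RCLike.imCLM (ψ τ)) := by
  obtain ⟨C, hC, h⟩ := exists_integral_translate_sub_le hn d k M L hδ hδ1 hk hb
  refine ⟨C, hC, fun c r Ψ ψ e β hr hΨ hψ hsupp hbd hM hL => ?_⟩
  have key : ∀ T : 𝕜 →L[ℝ] ℝ, ‖T‖ ≤ 1 → HasSmoothBound Ψ δ C fun τ => T (ψ τ) := by
    intro T hT
    refine h c r Ψ _ e β hr hΨ (T.contDiff.comp hψ) ((tsupport_clm_comp_subset ψ T).trans hsupp)
      hbd hM (fun τ hτ => ?_) fun τ hτ => ?_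
    · have h1 := hL τ hτ 0 zero_le_one
      rw [norm_iteratedFDeriv_zero] at h1
      exact (T.le_of_opNorm_le hT _).trans (by rwa [one_mul])
    · have h1 := hL τ hτ 1 le_rfl
      rw [← norm_iteratedFDeriv_fderiv, norm_iteratedFDeriv_zero] at h1
      exact (norm_fderiv_clm_comp_le hψ T hT τ).trans h1
  exact ⟨key _ norm_reCLM_le, key _ norm_imCLM_le⟩

theorem exists_forall_norm_iteratedFDeriv_le {E F : Type*} [NormedAddCommGroup E]
    [NormedSpace ℝ E] [NormedAddCommGroup F] [NormedSpace ℝ F] {f : E → F} {m : ℕ}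
    (hf : ContDiff ℝ m f) {K : Set E} (hK : IsCompact K) :
    ∃ M : ℝ, ∀ x ∈ K, ∀ j ≤ m, ‖iteratedFDeriv ℝ j f x‖ ≤ M := by
  have h1 : ∀ j : Fin (m + 1), ∃ M : ℝ, ∀ x ∈ K, ‖iteratedFDeriv ℝ j f x‖ ≤ M := fun j =>
    hK.exists_bound_of_continuousOn
      (hf.continuous_iteratedFDeriv (by exact_mod_cast Nat.le_of_lt_succ j.2)).continuousOn
  choose M₀ hM₀ using h1
  obtain ⟨M, hM⟩ := Finite.exists_le M₀
  exact ⟨M, fun x hx j hj => (hM₀ ⟨j, Nat.lt_succ_of_le hj⟩ x hx).trans (hM _)⟩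

theorem isLebesgueDensity_transport_iff {n d : ℕ} {c : Euc d} {R r : ℝ} {Φ Ψ : Euc d → Euc n}
    {ψ : Euc d → 𝕜} (h : IsTransportSetting c R Φ ψ) (hsupp : tsupport ψ ⊆ closedBall c r)
    (hΨ : Measurable Ψ) (heq : ∀ τ ∈ closedBall c r, Ψ τ = Φ τ) {g : Euc n → 𝕜} :
    IsLebesgueDensity (transport c R Φ ψ) g ↔
      Integrable g ∧ ∀ P, MeasurableSet P → ∫ y in P, g y = ∫ τ in Ψ ⁻¹' P, ψ τ := by
  unfold IsLebesgueDensity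
  refine and_congr_right fun hg => ⟨fun hd P hP => ?_, fun hd => ?_⟩
  · rw [← transport_apply h hsupp hΨ heq hP, hd, withDensityᵥ_apply hg hP]
  · refine VectorMeasure.ext fun P hP => ?_
    rw [transport_apply h hsupp hΨ heq hP, withDensityᵥ_apply hg hP, hd P hP]

end Assembly

end TransportedMeasure
end

/-! ### The theorem -/

open TransportedMeasure in
theorem proposition7p2 {𝕜 : Type*} [RCLike 𝕜] (n d k : ℕ) (hn : 1 ≤ n) :
    (∀ (c : Euc d) (R : ℝ) (Φ : Euc d → Euc n) (ψ : Euc d → 𝕜)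
        (e : Fin n ↪o Fin d) (α : Fin d → ℕ),
      IsTransportSetting c R Φ ψ →
      ∑ i, α i = k →
      (∀ τ ∈ closedBall c R,
        partialDeriv α (jacobianMinor Φ (closedBall c R) e) (closedBall c R) τ ≠ 0) →
      VectorMeasure.AbsolutelyContinuous (transport c R Φ ψ)
          (volume : Measure (Euc n)).toENNRealVectorMeasure ∧
        ∃ h : Euc n → 𝕜, IsLebesgueDensity (transport c R Φ ψ) h ∧
          ∀ δ : ℝ, 0 < δ → δ ≤ 1 → 2 * (k : ℝ) * δ < 1 → MemL1Delta δ h) ∧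
    (∀ δ M b L : ℝ, 0 < δ → δ ≤ 1 → 2 * (k : ℝ) * δ < 1 → 0 < b →
      ∃ C : ℝ, ∀ (c : Euc d) (R : ℝ) (Φ : Euc d → Euc n) (ψ : Euc d → 𝕜)
        (e : Fin n ↪o Fin d) (α : Fin d → ℕ),
      IsTransportSetting c R Φ ψ →
      ∑ i, α i = k →
      (∀ τ ∈ closedBall c R,
        b ≤ |partialDeriv α (jacobianMinor Φ (closedBall c R) e) (closedBall c R) τ|) →
      ckNorm (k + 2) Φ (closedBall c R) ≤ ENNReal.ofReal M →
      ckNorm 1 ψ (closedBall c R) ≤ ENNReal.ofReal L →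
      ∀ h : Euc n → 𝕜, IsLebesgueDensity (transport c R Φ ψ) h →
        l1DeltaNorm δ h ≤ ENNReal.ofReal C) := by
  constructor
  · intro c R Φ ψ e α hset hα hne
    obtain ⟨r, Ψ, hr0, hrR, hsupp, hΨ, hloc⟩ := hset.exists_contDiff_eventuallyEq
    obtain ⟨β, hβ⟩ := exists_partialDeriv_eq hα
    have hΨm := hΨ.continuous.measurable
    have heq : ∀ τ ∈ closedBall c r, Ψ τ = Φ τ := fun τ hτ => (hloc τ hτ).eq_of_nhds
    have hK := isCompact_closedBall c r
    have hDc : Continuous fun τ => iteratedFDeriv ℝ k (minor Ψ e) τ fun j => coordVec (β j) :=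
      ((contDiff_minor hΨ e).contDiff_iteratedFDeriv_apply k _).continuous
    -- The minimum over the smaller compact ball plays the role of `b`; no control up to the
    -- boundary of the large ball is needed.
    obtain ⟨τ₀, hτ₀, hmin⟩ := hK.exists_isMinOn ⟨c, mem_closedBall_self hr0.le⟩
      hDc.abs.continuousOn
    have hpos : 0 < |iteratedFDeriv ℝ k (minor Ψ e) τ₀ fun j => coordVec (β j)| := by
      rw [abs_pos, ← iteratedFDerivWithin_closedBall_eq hrR hτ₀
        (jacobianMinor_eventuallyEq hrR hτ₀ (hloc τ₀ hτ₀) e) k, ← hβ]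
      exact hne τ₀ (closedBall_subset_closedBall hrR.le hτ₀)
    obtain ⟨M, hM⟩ := exists_forall_norm_iteratedFDeriv_le (m := k + 2)
      (contDiff_infty.1 hΨ _) hK
    obtain ⟨L, hL⟩ := exists_forall_norm_iteratedFDeriv_le (m := 1) hset.contDiff_density hK
    have hbound : ∀ δ : ℝ, 0 < δ → δ ≤ 1 → 2 * (k : ℝ) * δ < 1 → ∃ C : ℝ, 0 ≤ C ∧
        HasSmoothBound Ψ δ C (fun τ => RCLike.reCLM (ψ τ)) ∧
        HasSmoothBound Ψ δ C (fun τ => RCLike.imCLM (ψ τ)) := by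
      intro δ hδ hδ1 hk
      obtain ⟨C, hC, h⟩ := exists_hasSmoothBound 𝕜 hn d k M L hδ hδ1 hk hpos
      exact ⟨C, hC, h c r Ψ ψ e β hr0 hΨ hset.contDiff_density hsupp (fun τ hτ => hmin hτ) hM hL⟩
    -- An exponent admissible for every `k`, including `0`. It yields absolute continuity and one
    -- density `h`, for which all other exponents are then checked.
    have hδ₀ : 0 < 1 / (2 * (k : ℝ) + 1) := by positivity
    have hδ₀1 : 1 / (2 * (k : ℝ) + 1) ≤ 1 := by
      rw [div_le_one (by positivity)]
      have : (0 : ℝ) ≤ k := Nat.cast_nonneg k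
      linarith
    have hkδ₀ : 2 * (k : ℝ) * (1 / (2 * (k : ℝ) + 1)) < 1 := by
      rw [mul_one_div, div_lt_one (by positivity)]
      linarith
    obtain ⟨C₀, hC₀, hre₀, him₀⟩ := hbound _ hδ₀ hδ₀1 hkδ₀
    refine ⟨VectorMeasure.AbsolutelyContinuous.mk fun P hP hv => ?_, ?_⟩
    · rw [Measure.toENNRealVectorMeasure_apply_measurable hP] at hv
      rw [transport_apply hset hsupp hΨm heq hP]
      exact setIntegral_preimage_eq_zero hδ₀ hC₀ hset.integrable hΨm hre₀ him₀ hP hv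
    · obtain ⟨h, hh, hd⟩ := exists_density hδ₀ hC₀ hset.integrable hΨm hre₀ him₀
      refine ⟨h, (isLebesgueDensity_transport_iff hset hsupp hΨm heq).2 ⟨hh, hd⟩,
        fun δ hδ hδ1 hk => ?_⟩
      obtain ⟨C, hC, hre, him⟩ := hbound δ hδ hδ1 hk
      exact ⟨memLp_one_iff_integrable.2 hh, _,
        hasTranslationBound_density hδ hC hset.integrable hΨm hh hd hre him⟩
  · intro δ M b L hδ hδ1 hk hb
    obtain ⟨C, hC, hbound⟩ := exists_hasSmoothBound 𝕜 hn d k (max M 0) (max L 0) hδ hδ1 hk hb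
    refine ⟨4 * C, fun c R Φ ψ e α hset hα hbd hM hL h hdens => ?_⟩
    obtain ⟨r, Ψ, hr0, hrR, hsupp, hΨ, hloc⟩ := hset.exists_contDiff_eventuallyEq
    obtain ⟨β, hβ⟩ := exists_partialDeriv_eq hα
    have hΨm := hΨ.continuous.measurable
    have heq : ∀ τ ∈ closedBall c r, Ψ τ = Φ τ := fun τ hτ => (hloc τ hτ).eq_of_nhds
    have hsub := closedBall_subset_closedBall (x := c) hrR.le
    obtain ⟨hh, hd⟩ := (isLebesgueDensity_transport_iff hset hsupp hΨm heq).1 hdens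
    obtain ⟨hre, him⟩ := hbound c r Ψ ψ e β hr0 hΨ hset.contDiff_density hsupp
      (fun τ hτ => by
        rw [← iteratedFDerivWithin_closedBall_eq hrR hτ
          (jacobianMinor_eventuallyEq hrR hτ (hloc τ hτ) e) k, ← hβ]
        exact hbd τ (hsub hτ))
      (fun τ hτ j hj => by
        rw [← iteratedFDerivWithin_closedBall_eq hrR hτ (hloc τ hτ) j]
        exact norm_iteratedFDerivWithin_le_of_ckNorm_le hM hj (hsub hτ))
      (fun τ hτ j hj => by
        rw [← iteratedFDerivWithin_closedBall_eq hrR hτ Filter.EventuallyEq.rfl j]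
        exact norm_iteratedFDerivWithin_le_of_ckNorm_le hL hj (hsub hτ))
    exact l1DeltaNorm_density_le hδ hC hset.integrable hΨm hh hd hre him
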